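/- Conventions: "increasing" and "decreasing" mean non-decreasing and non-increasing. A Lebesgue measurable function $\alpha:(0,\infty)\to(0,\infty)$ satisfies the non-quasianalyticity condition if $\int_1^{\infty}\alpha(t)\,t^{-2}\,dt<\infty$; it is subadditive if $\alpha(t_1+t_2)\le\alpha(t_1)+\alpha(t_2)$ for all $t_1,t_2>0$. A sequence $(t_j)_{j\ge1}$ in $(0,\infty]$ is called admissible if $$0<t_1\le\frac{t_2}{2}\le\frac{t_3}{3}\le\cdots\le+\infty,\qquad t_1<+\infty,\qquad \sum_{j=1}^{\infty}\frac1{t_j}<+\infty$$ (with $1/\infty=0$). $\mathbf{\Omega}_0$ denotes the set of all entire functions $\omega(z)=\prod_{j=1}^{\infty}\bigl(1+\frac{iz}{t_j}\bigr)$ with $(t_j)$ admissible. Theorem. For $f:(0,\infty)\to(0,\infty)$ the following conditions are equivalent: (i) $f\le\alpha$ on $(0,\infty)$ for some Lebesgue measurable, subadditive function $\alpha:(0,\infty)\to(0,\infty)$, bounded on $(0,1]$ and satisfying the non-quasianalyticity condition. (ii) $f\le\alpha$ on $(0,\infty)$ for some continuous function $\alpha:(0,\infty)\to(0,\infty)$,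 bounded on $(0,1]$ and satisfying the non-quasianalyticity condition, such that $t\mapsto\alpha(t)/t$ is decreasing on $(0,\infty)$. (iii) $f\le\alpha$ on $(0,\infty)$ for some increasing, concave function $\alpha:(0,\infty)\to(0,\infty)$ satisfying the non-quasianalyticity condition. (iv) $f\le\alpha$ on $(0,\infty)$ for some infinitely differentiable, increasing, concave function $\alpha:(0,\infty)\to(0,\infty)$ satisfying the non-quasianalyticity condition. (v) There exist an admissible sequence $(t_j)$ and a constant $c\ge0$ such that $$f(t)\le c+\ln\Bigl(1+\sum_{k=1}^{\infty}\frac{t^k}{t_1\cdots t_k}\Bigr),\qquad t>0.$$ (vi) There exist an admissible sequence $(t_j)$ and a constant $c\ge0$ such that $$f(t)\le c+\ln\max\Bigl(1,\ \sup_{k\ge1}\frac{t^k}{t_1t_2\cdots t_k}\Bigr),\qquad t>0.$$ (vii) There exist $\omega\in\mathbf{\Omega}_0$ and a constant $c\ge0$ such that $f(t)\le c+\ln|\omega(t)|$ for all $t>0$. Moreover, if $f$ satisfies these equivalent conditions, then $$\lim_{t\to+\infty}\frac{f(t)\ln t}{t}=0.$$ -/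

import Mathlib

open Set Filter MeasureTheory
open scoped Topology ContDiff ENNReal

namespace NonQuasi

/- Functions `(0, ∞) → (0, ∞)` are represented by functions `ℝ → ℝ` that are positive on `(0, ∞)`;
their values outside `(0, ∞)` never matter. "Increasing" and "decreasing" are meant in the wide
sense (non-decreasing, non-increasing). -/

/-- `α` maps `(0, ∞)` into `(0, ∞)`. -/
def PosOnPos (α : ℝ → ℝ) : Prop :=
  ∀ t : ℝ, 0 < t → 0 < α t

/-- `f(t) ≤ α(t)` for all `t > 0`. -/
def MajorizedBy (f α : ℝ → ℝ) : Prop :=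
  ∀ t : ℝ, 0 < t → f t ≤ α t

/-- `α` is Lebesgue measurable on `(0, ∞)`. (Almost everywhere equality with a Borel function with
respect to Lebesgue measure is the same as measurability for its completion.) -/
def LebesgueMeasurableOnPos (α : ℝ → ℝ) : Prop :=
  AEMeasurable α (volume.restrict (Ioi (0 : ℝ)))

/-- The non-quasianalyticity condition: `α` is Lebesgue measurable on `(0, ∞)` and
`∫_1^∞ α(t) / t² dt < ∞`. It is only used for positive functions. -/
def NonQuasianalytic (α : ℝ → ℝ) : Prop :=
  LebesgueMeasurableOnPos α ∧ IntegrableOn (fun t : ℝ => α t / t ^ 2) (Ioi (1 : ℝ))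

/-- `α` is subadditive on `(0, ∞)`. -/
def SubadditiveOnPos (α : ℝ → ℝ) : Prop :=
  ∀ s t : ℝ, 0 < s → 0 < t → α (s + t) ≤ α s + α t

/-- `α` is bounded on `(0, 1]`. -/
def BoundedNearZero (α : ℝ → ℝ) : Prop :=
  ∃ C : ℝ, ∀ t : ℝ, 0 < t → t ≤ 1 → |α t| ≤ C

/-- The sequences `0 < t₁ ≤ t₂ / 2 ≤ t₃ / 3 ≤ … ≤ +∞` with `t₁ < +∞` and `∑ 1 / t_j < +∞`.
The value `τ j` is `t_{j+1}`, and `1 / ∞ = 0`. -/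
structure AdmissibleSeq (τ : ℕ → ℝ≥0∞) : Prop where
  pos : 0 < τ 0
  lt_top : τ 0 < ⊤
  mono : Monotone fun k : ℕ => τ k / ((k : ℝ≥0∞) + 1)
  sum_lt_top : ∑' j : ℕ, (τ j)⁻¹ < ⊤

/-- The real number `1 / t_{j+1}`, equal to `0` if `t_{j+1} = ∞`. -/
noncomputable def recip (τ : ℕ → ℝ≥0∞) (j : ℕ) : ℝ :=
  ((τ j)⁻¹).toReal

/-- The term `t ^ k / (t₁ t₂ ⋯ t_k)`, equal to `0` as soon as one of `t₁, …, t_k` is `∞`. -/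
noncomputable def powTerm (τ : ℕ → ℝ≥0∞) (k : ℕ) (t : ℝ) : ℝ :=
  t ^ k * ∏ j ∈ Finset.range k, recip τ j

/-- For an admissible sequence the terms `t ^ k / (t₁ ⋯ t_k)` are summable, so that the sum and the
supremum below are the genuine ones. -/
theorem AdmissibleSeq.summable_powTerm {τ : ℕ → ℝ≥0∞} (h : AdmissibleSeq τ) (t : ℝ) :
    Summable fun k : ℕ => powTerm τ k t := by
  have h0 : Tendsto (recip τ) atTop (𝓝 0) :=
    (ENNReal.summable_toReal h.sum_lt_top.ne).tendsto_atTop_zero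
  have h1 : Tendsto (fun k => |t| * |recip τ k|) atTop (𝓝 0) := by
    simpa using (h0.abs.const_mul |t|)
  refine summable_of_ratio_norm_eventually_le (r := 1 / 2) (by norm_num) ?_
  filter_upwards [h1.eventually (gt_mem_nhds (show (0 : ℝ) < 1 / 2 by norm_num))] with k hk
  have e : powTerm τ (k + 1) t = t * recip τ k * powTerm τ k t := by
    simp only [powTerm, Finset.prod_range_succ, pow_succ]
    ring
  rw [e, norm_mul, Real.norm_eq_abs, abs_mul]
  exact mul_le_mul_of_nonneg_right hk.le (norm_nonneg _)

/-- `t ↦ ln (1 + ∑_{k ≥ 1} t ^ k / (t₁ ⋯ t_k))`. -/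
noncomputable def logSeries (τ : ℕ → ℝ≥0∞) (t : ℝ) : ℝ :=
  Real.log (1 + ∑' k : ℕ, powTerm τ (k + 1) t)

/-- `t ↦ ln max (1, sup_{k ≥ 1} t ^ k / (t₁ ⋯ t_k))`. -/
noncomputable def logMax (τ : ℕ → ℝ≥0∞) (t : ℝ) : ℝ :=
  Real.log (max 1 (⨆ k : ℕ, powTerm τ (k + 1) t))

/-- The set `Ω₀` of the entire functions `ω(z) = ∏_{j ≥ 1} (1 + i z / t_j)`, where
`0 < t₁ ≤ t₂ / 2 ≤ t₃ / 3 ≤ … ≤ +∞`, `t₁ < +∞`, `∑ 1 / t_j < +∞`. -/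
def Omega0 : Set (ℂ → ℂ) :=
  {w | ∃ τ : ℕ → ℝ≥0∞, AdmissibleSeq τ ∧
    ∀ z : ℂ, HasProd (fun j : ℕ => 1 + Complex.I * z * (recip τ j : ℂ)) (w z)}

end NonQuasi

/-! Everything passes through one dyadic-type condition, `HasSummableSlopes`: beyond `4 ^ k` the
function lies under a line of slope `H k`, up to a constant, with `∑ H k < ∞`. This is the discrete
form of a convergent integral of `f(t)/t²`.

Two conditions imply it. For a subadditive `α`, averaging `α(u) ≤ α(s) + α(u - s)` over `s` bounds
`α(u)/u` by a piece of the integral (`SubadditiveOnPos.le_integral`). For `ω`, the function `L(t) =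
∑ ½ ln(1 + t²/t_j²)` bounds `ln |ω(t)|`; it is almost subadditive because `t_j / j` increases
(`logProd_nsmul_le`), and `∑ L(4 ^ k) / 4 ^ k` is controlled by `∑ 1/t_j` (`summable_logProd_div`).

Conversely, the slopes may be taken to be a decreasing summable sequence `G`. The mixture `β(t) = 5
∑ (G i - G (i+1)) t / (1 + t / 4 ^ i)` of smooth increasing concave functions majorizes `f` up to a
constant and has a convergent integral, since summation by parts gives `∑ (i+1)(G i - G (i+1)) < ∞`.
The points where `β` reaches `1, 2, 3, …`, divided by `e`, form an admissible sequence whose maximal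
term dominates `exp(β - 1)`. The limit at infinity follows from `(k+1) G k → 0`. -/

namespace NonQuasi

/-! ### Passage between admissible sequences and their reciprocals. -/

/-- The reciprocals `ρ j = 1 / t_{j+1}` of an admissible sequence. -/
structure AdmissibleRecip (ρ : ℕ → ℝ) : Prop where
  nonneg : ∀ j, 0 ≤ ρ j
  pos : 0 < ρ 0
  anti : Antitone fun k : ℕ => ((k : ℝ) + 1) * ρ k
  summable : Summable ρ

theorem AdmissibleSeq.pos' {τ : ℕ → ℝ≥0∞} (h : AdmissibleSeq τ) (j : ℕ) : τ j ≠ 0 := by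
  intro hj
  have h1 := h.mono (Nat.zero_le j)
  simp only [hj, ENNReal.zero_div, Nat.cast_zero, zero_add, div_one] at h1
  exact h.pos.ne' (le_antisymm h1 zero_le)

theorem AdmissibleSeq.admissibleRecip {τ : ℕ → ℝ≥0∞} (h : AdmissibleSeq τ) :
    AdmissibleRecip (recip τ) where
  nonneg _ := ENNReal.toReal_nonneg
  pos := ENNReal.toReal_pos (ENNReal.inv_ne_zero.2 h.lt_top.ne) (ENNReal.inv_ne_top.2 h.pos.ne')
  summable := ENNReal.summable_toReal h.sum_lt_top.ne
  anti := by
    have key : ∀ k : ℕ, ((k : ℝ) + 1) * recip τ k = ((τ k / ((k : ℝ≥0∞) + 1))⁻¹).toReal := by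
      intro k
      rw [ENNReal.inv_div (Or.inl (by finiteness)) (Or.inl (by simp)), ENNReal.div_eq_inv_mul,
        ENNReal.toReal_mul, mul_comm, recip]
      congr 1
    intro i j hij
    simp only [key]
    apply ENNReal.toReal_mono
    · rw [ENNReal.inv_ne_top]
      exact (ENNReal.div_pos (h.pos' i) (by finiteness)).ne'
    · exact ENNReal.inv_le_inv.2 (h.mono hij)

theorem recip_inv_ofReal {ρ : ℕ → ℝ} (h : ∀ j, 0 ≤ ρ j) :
    recip (fun j => (ENNReal.ofReal (ρ j))⁻¹) = ρ := by
  funext j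
  simp [recip, h j]

theorem AdmissibleRecip.admissibleSeq {ρ : ℕ → ℝ} (h : AdmissibleRecip ρ) :
    AdmissibleSeq (fun j => (ENNReal.ofReal (ρ j))⁻¹) where
  pos := by simp
  lt_top := by simpa using h.pos
  sum_lt_top := by
    simp only [inv_inv]
    rw [← ENNReal.ofReal_tsum_of_nonneg h.nonneg h.summable]
    exact ENNReal.ofReal_lt_top
  mono := by
    have key : ∀ k : ℕ, (ENNReal.ofReal (ρ k))⁻¹ / ((k : ℝ≥0∞) + 1)
        = (ENNReal.ofReal (((k : ℝ) + 1) * ρ k))⁻¹ := by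
      intro k
      rw [ENNReal.ofReal_mul (by positivity), ENNReal.mul_inv (Or.inl (by simp; positivity))
        (Or.inl (by simp)), ENNReal.div_eq_inv_mul]
      congr 2
      rw [ENNReal.ofReal_add (by positivity) (by positivity)]
      simp
    intro i j hij
    simp only [key]
    exact ENNReal.inv_le_inv.2 (ENNReal.ofReal_le_ofReal (h.anti hij))

theorem AdmissibleRecip.const_mul {ρ : ℕ → ℝ} (h : AdmissibleRecip ρ) {c : ℝ} (hc : 0 < c) :
    AdmissibleRecip (fun j => c * ρ j) where
  nonneg j := mul_nonneg hc.le (h.nonneg j)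
  pos := mul_pos hc h.pos
  summable := h.summable.mul_left c
  anti := by
    intro i j hij
    have := mul_le_mul_of_nonneg_left (h.anti hij) hc.le
    simp only at this ⊢
    linarith

/-! ### Comparison of the maximal term, the series and the product. -/

theorem powTerm_nonneg (τ : ℕ → ℝ≥0∞) (k : ℕ) {t : ℝ} (ht : 0 ≤ t) : 0 ≤ powTerm τ k t :=
  mul_nonneg (pow_nonneg ht k) (Finset.prod_nonneg fun _ _ => ENNReal.toReal_nonneg)

theorem AdmissibleSeq.bddAbove_powTerm {τ : ℕ → ℝ≥0∞} (h : AdmissibleSeq τ) {t : ℝ} (ht : 0 ≤ t) :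
    BddAbove (range fun k : ℕ => powTerm τ (k + 1) t) := by
  refine ⟨∑' k, powTerm τ k t, ?_⟩
  rintro _ ⟨k, rfl⟩
  exact (h.summable_powTerm t).le_tsum (k + 1) fun j _ => powTerm_nonneg τ j ht

theorem AdmissibleSeq.logMax_le_logSeries {τ : ℕ → ℝ≥0∞} (h : AdmissibleSeq τ) {t : ℝ}
    (ht : 0 ≤ t) : logMax τ t ≤ logSeries τ t := by
  have hs : Summable fun k => powTerm τ (k + 1) t :=
    (summable_nat_add_iff (f := fun k => powTerm τ k t) 1).2 (h.summable_powTerm t)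
  have h0 : 0 ≤ ∑' k, powTerm τ (k + 1) t := tsum_nonneg fun k => powTerm_nonneg τ _ ht
  refine Real.log_le_log (lt_of_lt_of_le one_pos (le_max_left _ _)) (max_le (by linarith) ?_)
  refine (ciSup_le fun k => ?_).trans (le_add_of_nonneg_left zero_le_one)
  exact hs.le_tsum k fun j _ => powTerm_nonneg τ _ ht

theorem one_le_norm_factor (x : ℝ) : 1 ≤ ‖1 + Complex.I * (x : ℂ)‖ := by
  refine le_trans ?_ (Complex.abs_re_le_norm _)
  simp

theorem le_norm_factor (x : ℝ) : x ≤ ‖1 + Complex.I * (x : ℂ)‖ := by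
  refine le_trans ?_ (Complex.abs_im_le_norm _)
  simpa using le_abs_self x

theorem norm_factor (x : ℝ) :
    ‖1 + Complex.I * (x : ℂ)‖ = Real.exp (1 / 2 * Real.log (1 + x ^ 2)) := by
  have h : (0 : ℝ) < 1 + x ^ 2 := by positivity
  have e : ‖1 + Complex.I * (x : ℂ)‖ = √(1 + x ^ 2) := by
    rw [Complex.norm_eq_sqrt_sq_add_sq]
    simp
  rw [e, Real.sqrt_eq_rpow, Real.rpow_def_of_pos h, mul_comm]

theorem factor_eq (t r : ℝ) :
    1 + Complex.I * (t : ℂ) * (r : ℂ) = 1 + Complex.I * ((t * r : ℝ) : ℂ) := by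
  push_cast
  ring

theorem AdmissibleRecip.exists_omega {ρ : ℕ → ℝ} (h : AdmissibleRecip ρ) :
    ∃ w ∈ Omega0, ∀ z : ℂ, HasProd (fun j : ℕ => 1 + Complex.I * z * (ρ j : ℂ)) (w z) := by
  have key : ∀ z : ℂ, Multipliable fun j : ℕ => 1 + Complex.I * z * (ρ j : ℂ) := by
    intro z
    apply multipliable_one_add_of_summable
    refine (h.summable.mul_left ‖Complex.I * z‖).congr fun j => ?_
    rw [norm_mul (Complex.I * z), Complex.norm_real, Real.norm_of_nonneg (h.nonneg j)]
  refine ⟨fun z => ∏' j : ℕ, (1 + Complex.I * z * (ρ j : ℂ)), ⟨_, h.admissibleSeq, ?_⟩,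
    fun z => (key z).hasProd⟩
  rw [recip_inv_ofReal h.nonneg]
  exact fun z => (key z).hasProd

theorem tendsto_norm_partialProd {ρ : ℕ → ℝ} {t : ℝ} {v : ℂ}
    (hv : HasProd (fun j : ℕ => 1 + Complex.I * (t : ℂ) * (ρ j : ℂ)) v) :
    Tendsto (fun n => ∏ j ∈ Finset.range n, ‖1 + Complex.I * ((t * ρ j : ℝ) : ℂ)‖) atTop
      (𝓝 ‖v‖) := by
  have := hv.norm.tendsto_prod_nat
  simpa only [factor_eq] using this

/-- Each factor has modulus at least `t * ρ j` and at least `1`: use the first bound for `j < k` and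
the second for the other factors. -/
theorem powTerm_le_norm {ρ : ℕ → ℝ} {t : ℝ} {v : ℂ} (hρ : ∀ j, 0 ≤ ρ j) (ht : 0 ≤ t)
    (hv : HasProd (fun j : ℕ => 1 + Complex.I * (t : ℂ) * (ρ j : ℂ)) v) (k : ℕ) :
    t ^ k * ∏ j ∈ Finset.range k, ρ j ≤ ‖v‖ := by
  have e : t ^ k * ∏ j ∈ Finset.range k, ρ j = ∏ j ∈ Finset.range k, (t * ρ j) := by
    rw [Finset.prod_mul_distrib, Finset.prod_const, Finset.card_range]
  rw [e]
  refine ge_of_tendsto (tendsto_norm_partialProd hv) ?_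
  filter_upwards [eventually_ge_atTop k] with n hn
  calc _ ≤ ∏ j ∈ Finset.range k, ‖1 + Complex.I * ((t * ρ j : ℝ) : ℂ)‖ :=
        Finset.prod_le_prod (fun j _ => mul_nonneg ht (hρ j)) fun j _ => le_norm_factor _
    _ ≤ _ := Finset.prod_le_prod_of_subset_of_one_le (Finset.range_mono hn)
        (fun _ _ => norm_nonneg _) fun _ _ _ => one_le_norm_factor _

theorem AdmissibleSeq.logSeries_le {τ : ℕ → ℝ≥0∞} (h : AdmissibleSeq τ) :
    ∃ w ∈ Omega0, ∀ t : ℝ, 0 < t → logSeries τ t ≤ Real.log 2 + Real.log ‖w (t : ℂ)‖ := by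
  -- Doubling the reciprocals multiplies the `k`-th term by `2 ^ k`, so the original terms are at
  -- most `(1/2) ^ k * ‖w t‖` and sum to at most `2 * ‖w t‖`.
  obtain ⟨w, hw, hprod⟩ := (h.admissibleRecip.const_mul two_pos).exists_omega
  refine ⟨w, hw, fun t ht => ?_⟩
  have hle := powTerm_le_norm (h.admissibleRecip.const_mul two_pos).nonneg ht.le (hprod t)
  have h1 : 1 ≤ ‖w t‖ := by simpa using hle 0
  have hs : Summable fun k => powTerm τ (k + 1) t :=
    (summable_nat_add_iff (f := fun k => powTerm τ k t) 1).2 (h.summable_powTerm t)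
  have hterm : ∀ k, powTerm τ k t ≤ (1 / 2) ^ k * ‖w t‖ := by
    intro k
    have h2 := hle k
    rw [Finset.prod_mul_distrib, Finset.prod_const, Finset.card_range] at h2
    have h3 : powTerm τ k t
        = (1 / 2) ^ k * (t ^ k * (2 ^ k * ∏ j ∈ Finset.range k, recip τ j)) := by
      rw [powTerm]
      have : (1 / 2 : ℝ) ^ k * 2 ^ k = 1 := by rw [← mul_pow]; norm_num
      linear_combination (- t ^ k * ∏ j ∈ Finset.range k, recip τ j) * this
    rw [h3]
    exact mul_le_mul_of_nonneg_left h2 (by positivity)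
  have hsum : 1 + ∑' k, powTerm τ (k + 1) t ≤ 2 * ‖w t‖ := by
    have e : 1 + ∑' k, powTerm τ (k + 1) t = ∑' k, powTerm τ k t := by
      rw [(h.summable_powTerm t).tsum_eq_zero_add]
      simp [powTerm]
    rw [e, ← tsum_geometric_two, ← tsum_mul_right]
    exact (h.summable_powTerm t).tsum_le_tsum hterm (summable_geometric_two.mul_right _)
  have h0 : 0 ≤ ∑' k, powTerm τ (k + 1) t := tsum_nonneg fun k => powTerm_nonneg τ _ ht.le
  rw [← Real.log_mul (by norm_num) (by linarith)]
  exact Real.log_le_log (by linarith) hsum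

/-! ### The slope condition and elementary logarithmic estimates. -/

/-- Up to a constant, `f t / t` is bounded by the terms of a convergent series on `[4 ^ k, ∞)`. -/
def HasSummableSlopes (f : ℝ → ℝ) : Prop :=
  ∃ (c : ℝ) (H : ℕ → ℝ), 0 ≤ c ∧ (∀ k, 0 ≤ H k) ∧ Summable H ∧ (∀ t, 0 < t → t ≤ 1 → f t ≤ c) ∧
    ∀ k t, (4 : ℝ) ^ k ≤ t → f t ≤ c + t * H k

/-- With `n = ⌊s / a⌋`, the inequalities `n ≤ s / a < n + 1 ≤ 2 * n` place `u = s / n` in `[a, 2 *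
a]`, and `s = n * u`. -/
theorem le_mul_of_nsmul_le {α : ℝ → ℝ} {H a s : ℝ} (ha : 0 < a)
    (h : ∀ u, a ≤ u → u ≤ 2 * a → ∀ n : ℕ, 1 ≤ n → α (n * u) ≤ n * u * H) (hs : a ≤ s) :
    α s ≤ s * H := by
  have h1 : 1 ≤ s / a := (one_le_div ha).2 hs
  have hn : 1 ≤ ⌊s / a⌋₊ := Nat.le_floor (by simpa using h1)
  have hn' : (1 : ℝ) ≤ (⌊s / a⌋₊ : ℝ) := by exact_mod_cast hn
  have h2 : (⌊s / a⌋₊ : ℝ) ≤ s / a := Nat.floor_le (by linarith)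
  have h3 : s / a < ⌊s / a⌋₊ + 1 := Nat.lt_floor_add_one _
  have e : (⌊s / a⌋₊ : ℝ) * (s / ⌊s / a⌋₊) = s := by field_simp
  have := h (s / ⌊s / a⌋₊) ?_ ?_ _ hn
  · rwa [e] at this
  · rw [le_div_iff₀ (by linarith)]
    rw [le_div_iff₀ ha] at h2
    linarith
  · rw [div_le_iff₀ (by linarith)]
    rw [div_lt_iff₀ ha] at h3
    nlinarith

/-- `½ ln (1 + x²)`. -/
noncomputable def halfLog (x : ℝ) : ℝ := 1 / 2 * Real.log (1 + x ^ 2)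

theorem halfLog_nonneg (x : ℝ) : 0 ≤ halfLog x :=
  mul_nonneg (by norm_num) (Real.log_nonneg (by nlinarith [sq_nonneg x]))

theorem halfLog_mono {x y : ℝ} (hx : 0 ≤ x) (h : x ≤ y) : halfLog x ≤ halfLog y := by
  have := Real.log_le_log (by positivity : 0 < 1 + x ^ 2)
    (by gcongr : 1 + x ^ 2 ≤ 1 + y ^ 2)
  unfold halfLog
  linarith

theorem halfLog_le_sq (x : ℝ) : halfLog x ≤ x ^ 2 / 2 := by
  have := Real.log_le_sub_one_of_pos (by positivity : 0 < 1 + x ^ 2)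
  unfold halfLog
  linarith

theorem halfLog_le_log {x : ℝ} (hx : 0 ≤ x) : halfLog x ≤ Real.log (1 + x) := by
  have h : Real.log (1 + x ^ 2) ≤ Real.log ((1 + x) ^ 2) :=
    Real.log_le_log (by positivity) (by nlinarith)
  rw [Real.log_pow] at h
  push_cast at h
  unfold halfLog
  linarith

theorem halfLog_le {x : ℝ} (hx : 0 ≤ x) : halfLog x ≤ x := by
  have := Real.log_le_sub_one_of_pos (by positivity : 0 < 1 + x)
  linarith [halfLog_le_log hx]

theorem halfLog_mul_le {x c : ℝ} (hc : 1 ≤ c) : halfLog (c * x) ≤ halfLog x + Real.log c := by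
  have h : Real.log (1 + (c * x) ^ 2) ≤ Real.log ((1 + x ^ 2) * c ^ 2) :=
    Real.log_le_log (by positivity) (by nlinarith [sq_nonneg x])
  rw [Real.log_mul (by positivity) (by positivity), Real.log_pow] at h
  push_cast at h
  unfold halfLog
  linarith

theorem halfLog_sq_mul_le {y : ℝ} (hy : 0 ≤ y) :
    halfLog (y ^ 2) * ((1 + y) * (1 + 2 * y)) ≤ 12 * y ^ 3 := by
  rcases le_total y 1 with h | h
  · have h1 := halfLog_le_sq (y ^ 2)
    have h2 : (1 + y) * (1 + 2 * y) ≤ 6 := by nlinarith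
    have h4 : y ^ 4 ≤ y ^ 3 := pow_le_pow_of_le_one hy h (by norm_num)
    calc _ ≤ (y ^ 2) ^ 2 / 2 * 6 := by gcongr
      _ ≤ 12 * y ^ 3 := by nlinarith [pow_nonneg hy 3]
  · have h1 : halfLog (y ^ 2) ≤ 2 * y := by
      refine (halfLog_le_log (by positivity)).trans ?_
      have h3 : Real.log (1 + y ^ 2) ≤ Real.log ((1 + y) ^ 2) :=
        Real.log_le_log (by positivity) (by nlinarith)
      rw [Real.log_pow] at h3
      push_cast at h3
      have := Real.log_le_sub_one_of_pos (by positivity : 0 < 1 + y)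
      linarith
    calc _ ≤ 2 * y * ((y + y) * (y + 2 * y)) := by gcongr
      _ = 12 * y ^ 3 := by ring

/-- The quotient is `O(x)` at `0` and `O(x ^ (-1/2))` at infinity, like the increment of `√x / (1 +
√x)` from `x` to `4 * x`; such increments telescope along powers of `4`. -/
theorem halfLog_div_le {x : ℝ} (hx : 0 < x) :
    halfLog x / x ≤ 12 * (√(4 * x) / (1 + √(4 * x)) - √x / (1 + √x)) := by
  have h4 : √(4 * x) = 2 * √x := by
    rw [Real.sqrt_mul (by norm_num), show (4 : ℝ) = 2 ^ 2 by norm_num, Real.sqrt_sq (by norm_num)]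
  have hy : 0 < √x := Real.sqrt_pos.2 hx
  have hxy : x = √x ^ 2 := (Real.sq_sqrt hx.le).symm
  rw [h4]
  generalize √x = y at *
  subst hxy
  have h := halfLog_sq_mul_le hy.le
  have e : 12 * (2 * y / (1 + 2 * y) - y / (1 + y)) = 12 * y / ((1 + y) * (1 + 2 * y)) := by
    field_simp
    ring
  rw [e, div_le_div_iff₀ (by positivity) (by positivity)]
  linarith

/-- Discrete analogue of `∫ ½ ln(1 + r²t²) t⁻² dt = O(r)`: the bound is linear in `r` and uniform in
`n`. -/
theorem sum_halfLog_div_le {r : ℝ} (hr : 0 ≤ r) (n : ℕ) :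
    ∑ k ∈ Finset.range n, halfLog (4 ^ k * r) / 4 ^ k ≤ 12 * r := by
  rcases hr.eq_or_lt with rfl | hr
  · simp [halfLog]
  set Φ : ℕ → ℝ := fun k => √(4 ^ k * r) / (1 + √(4 ^ k * r)) with hΦ
  have hΦ0 : 0 ≤ Φ 0 := by positivity
  have hΦ1 : Φ n ≤ 1 := by
    have := Real.sqrt_nonneg (4 ^ n * r)
    exact (div_le_one (by positivity)).2 (by linarith)
  have hle : ∀ k, halfLog (4 ^ k * r) / 4 ^ k ≤ 12 * r * (Φ (k + 1) - Φ k) := by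
    intro k
    have h := mul_le_mul_of_nonneg_left
      (halfLog_div_le (show 0 < 4 ^ k * r by positivity)) hr.le
    have e1 : r * (halfLog (4 ^ k * r) / (4 ^ k * r)) = halfLog (4 ^ k * r) / 4 ^ k := by
      field_simp
    have e2 : 4 * (4 ^ k * r) = 4 ^ (k + 1) * r := by ring
    rw [e1, e2] at h
    refine h.trans (le_of_eq ?_)
    simp only [hΦ]
    ring
  calc _ ≤ ∑ k ∈ Finset.range n, 12 * r * (Φ (k + 1) - Φ k) := Finset.sum_le_sum fun k _ => hle k
    _ = 12 * r * (Φ n - Φ 0) := by rw [← Finset.mul_sum, Finset.sum_range_sub]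
    _ ≤ 12 * r := by nlinarith

/-- The sum is `ln (n ^ n / n!)`, and `n ^ n / n!` is one term of the series of `exp n`. -/
theorem sum_log_div_le (n : ℕ) :
    ∑ r ∈ Finset.range n, Real.log ((n : ℝ) / (r + 1)) ≤ n := by
  rcases Nat.eq_zero_or_pos n with rfl | hn
  · simp
  have hn' : (0 : ℝ) < n := by exact_mod_cast hn
  rw [← Real.log_prod fun r _ => by positivity, Finset.prod_div_distrib, Finset.prod_const,
    Finset.card_range]
  have e : ∏ r ∈ Finset.range n, ((r : ℝ) + 1) = (n.factorial : ℝ) := by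
    rw [← Finset.prod_range_add_one_eq_factorial]
    push_cast
    rfl
  rw [e, Real.log_le_iff_le_exp (by positivity)]
  exact Real.pow_div_factorial_le_exp _ hn'.le n

/-! ### Growth of `ln |ω|` on the positive axis. -/

namespace AdmissibleRecip

variable {ρ : ℕ → ℝ}

theorem summable_halfLog (h : AdmissibleRecip ρ) {t : ℝ} (ht : 0 ≤ t) :
    Summable fun j => halfLog (t * ρ j) :=
  Summable.of_nonneg_of_le (fun _ => halfLog_nonneg _)
    (fun j => halfLog_le (mul_nonneg ht (h.nonneg j))) (h.summable.mul_left t)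

/-- For `j < n`, `ρ j ≤ ρ 0 / (j + 1)`, so each argument is at most `n / (j + 1) ≥ 1` times `t * ρ
0`. The excess `ln (n / (j + 1))` sums to at most `n`. -/
theorem sum_halfLog_block_le (h : AdmissibleRecip ρ) {t : ℝ} (ht : 0 ≤ t) (n : ℕ) :
    ∑ j ∈ Finset.range n, halfLog (n * t * ρ j) ≤ n * (halfLog (t * ρ 0) + 1) := by
  have hle : ∀ j ∈ Finset.range n,
      halfLog (n * t * ρ j) ≤ halfLog (t * ρ 0) + Real.log ((n : ℝ) / (j + 1)) := by
    intro j hj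
    have hjn : (j : ℝ) + 1 ≤ n := by exact_mod_cast Finset.mem_range.1 hj
    have hj0 : (0 : ℝ) < (j : ℝ) + 1 := by positivity
    have h1 : ((j : ℝ) + 1) * ρ j ≤ ρ 0 := by simpa using h.anti (Nat.zero_le j)
    refine le_trans (halfLog_mono ?_ ?_) (halfLog_mul_le ((one_le_div hj0).2 hjn))
    · have := h.nonneg j
      positivity
    · have e : n * t * ρ j = n / ((j : ℝ) + 1) * (t * (((j : ℝ) + 1) * ρ j)) := by field_simp
      rw [e]
      gcongr
  refine (Finset.sum_le_sum hle).trans ?_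
  rw [Finset.sum_add_distrib, Finset.sum_const, Finset.card_range, nsmul_eq_mul]
  linarith [sum_log_div_le n]

/-- After the initial block, the `n` indices `n * (m + 1) + r` satisfy `n * ρ (n * (m + 1) + r) ≤ ρ
m`, because `(k + 1) * ρ k` decreases. Each such block therefore costs at most `n` times one term at
`t`. -/
theorem sum_halfLog_blocks_le (h : AdmissibleRecip ρ) {t : ℝ} (ht : 0 ≤ t) (n m : ℕ) :
    ∑ j ∈ Finset.range (n * (m + 1)), halfLog (n * t * ρ j)
      ≤ n * (halfLog (t * ρ 0) + 1 + ∑ i ∈ Finset.range m, halfLog (t * ρ i)) := by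
  induction m with
  | zero => simpa using h.sum_halfLog_block_le ht n
  | succ m ih =>
    rw [mul_add n (m + 1) 1, mul_one, Finset.sum_range_add, Finset.sum_range_succ]
    have hle : ∀ r ∈ Finset.range n,
        halfLog (n * t * ρ (n * (m + 1) + r)) ≤ halfLog (t * ρ m) := by
      intro r _
      have hr0 := h.nonneg (n * (m + 1) + r)
      refine halfLog_mono (by positivity) ?_
      rw [mul_comm (n : ℝ) t, mul_assoc]
      refine mul_le_mul_of_nonneg_left ?_ ht
      rcases Nat.eq_zero_or_pos n with rfl | hn
      · simpa using h.nonneg m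
      have h1 := h.anti (show m ≤ n * (m + 1) + r by nlinarith)
      simp only at h1
      push_cast at h1
      have hm : (0 : ℝ) < (m : ℝ) + 1 := by positivity
      have h2 : (n : ℝ) * (m + 1) ≤ n * (m + 1) + r + 1 := by
        have : (0 : ℝ) ≤ r := by positivity
        linarith
      have h3 := (mul_le_mul_of_nonneg_right h2 hr0).trans h1
      have h4 : ((m : ℝ) + 1) * (n * ρ (n * (m + 1) + r)) ≤ (m + 1) * ρ m := by linarith
      exact le_of_mul_le_mul_left h4 hm
    have h5 := Finset.sum_le_sum hle
    rw [Finset.sum_const, Finset.card_range, nsmul_eq_mul] at h5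
    nlinarith

/-- `∑ j, ½ ln (1 + t² / t_j²)`. -/
noncomputable def logProd (ρ : ℕ → ℝ) (t : ℝ) : ℝ := ∑' j, halfLog (t * ρ j)

theorem logProd_nonneg (ρ : ℕ → ℝ) (t : ℝ) : 0 ≤ logProd ρ t :=
  tsum_nonneg fun _ => halfLog_nonneg _

theorem logProd_mono (h : AdmissibleRecip ρ) {s t : ℝ} (hs : 0 ≤ s) (hst : s ≤ t) :
    logProd ρ s ≤ logProd ρ t :=
  (h.summable_halfLog hs).tsum_le_tsum
    (fun j => halfLog_mono (mul_nonneg hs (h.nonneg j))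
      (mul_le_mul_of_nonneg_right hst (h.nonneg j)))
    (h.summable_halfLog (hs.trans hst))

/-- A substitute for subadditivity. The factor `2` appears because `ρ 0` serves both the initial
block and the next one. -/
theorem logProd_nsmul_le (h : AdmissibleRecip ρ) {t : ℝ} (ht : 0 ≤ t) {n : ℕ} (hn : 1 ≤ n) :
    logProd ρ (n * t) ≤ n * (2 * logProd ρ t + 1) := by
  refine Real.tsum_le_of_sum_range_le (fun _ => halfLog_nonneg _) fun m => ?_
  have h0 : halfLog (t * ρ 0) ≤ logProd ρ t :=
    (h.summable_halfLog ht).le_tsum 0 fun _ _ => halfLog_nonneg _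
  have h1 : ∑ i ∈ Finset.range m, halfLog (t * ρ i) ≤ logProd ρ t :=
    (h.summable_halfLog ht).sum_le_tsum _ fun _ _ => halfLog_nonneg _
  calc _ ≤ ∑ j ∈ Finset.range (n * (m + 1)), halfLog (n * t * ρ j) :=
        Finset.sum_le_sum_of_subset_of_nonneg (Finset.range_mono (by nlinarith))
          fun _ _ _ => halfLog_nonneg _
    _ ≤ _ := h.sum_halfLog_blocks_le ht n m
    _ ≤ _ := mul_le_mul_of_nonneg_left (by linarith) (by positivity)

theorem summable_logProd_div (h : AdmissibleRecip ρ) :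
    Summable fun k : ℕ => logProd ρ (4 ^ k) / 4 ^ k := by
  refine summable_of_sum_range_le (c := ∑' j, 12 * ρ j)
    (fun k => div_nonneg (logProd_nonneg _ _) (by positivity)) fun n => ?_
  have hs : ∀ k ∈ Finset.range n, Summable fun j => halfLog (4 ^ k * ρ j) / 4 ^ k :=
    fun k _ => (h.summable_halfLog (by positivity)).div_const _
  have e : ∑ k ∈ Finset.range n, logProd ρ (4 ^ k) / 4 ^ k
      = ∑' j, ∑ k ∈ Finset.range n, halfLog (4 ^ k * ρ j) / 4 ^ k := by
    rw [Summable.tsum_finsetSum hs]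
    simp only [logProd, tsum_div_const]
  rw [e]
  exact (summable_sum hs).tsum_le_tsum (fun j => sum_halfLog_div_le (h.nonneg j) n)
    (h.summable.mul_left 12)

theorem log_norm_le_logProd (h : AdmissibleRecip ρ) {t : ℝ} (ht : 0 ≤ t) {v : ℂ}
    (hv : HasProd (fun j : ℕ => 1 + Complex.I * (t : ℂ) * (ρ j : ℂ)) v) :
    Real.log ‖v‖ ≤ logProd ρ t := by
  have h1 : 1 ≤ ‖v‖ := by simpa using powTerm_le_norm h.nonneg ht hv 0
  rw [Real.log_le_iff_le_exp (by linarith)]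
  refine le_of_tendsto (tendsto_norm_partialProd hv) (Eventually.of_forall fun n => ?_)
  simp only [norm_factor]
  rw [← Real.exp_sum]
  exact Real.exp_le_exp.2 ((h.summable_halfLog ht).sum_le_tsum _ fun _ _ => halfLog_nonneg _)

theorem logProd_le_slope (h : AdmissibleRecip ρ) (k : ℕ) {t : ℝ} (ht : (4 : ℝ) ^ k ≤ t) :
    logProd ρ t ≤ t * (8 * (logProd ρ (4 ^ (k + 1)) / 4 ^ (k + 1)) + (1 / 4) ^ k) := by
  refine le_mul_of_nsmul_le (by positivity) (fun u hu hu2 n hn => ?_) ht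
  have hu0 : 0 < u := lt_of_lt_of_le (by positivity) hu
  refine (h.logProd_nsmul_le hu0.le hn).trans ?_
  rw [mul_assoc]
  refine mul_le_mul_of_nonneg_left ?_ (by positivity)
  have h1 : logProd ρ u ≤ logProd ρ (4 ^ (k + 1)) :=
    h.logProd_mono hu0.le (by rw [pow_succ]; linarith [pow_pos (four_pos : (0 : ℝ) < 4) k])
  have h2 : 0 ≤ logProd ρ (4 ^ (k + 1)) := logProd_nonneg _ _
  have hnn : 0 ≤ 8 * (logProd ρ (4 ^ (k + 1)) / 4 ^ (k + 1)) + (1 / 4 : ℝ) ^ k := by positivity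
  refine le_trans ?_ (mul_le_mul_of_nonneg_right hu hnn)
  -- The constants in the slope are chosen so that, already at `u = 4 ^ k`, it yields `2 * logProd ρ
  -- (4 ^ (k + 1)) + 1`.
  have e : (4 : ℝ) ^ k * (8 * (logProd ρ (4 ^ (k + 1)) / 4 ^ (k + 1)) + (1 / 4) ^ k)
      = 2 * logProd ρ (4 ^ (k + 1)) + 1 := by
    rw [pow_succ (4 : ℝ) k, div_pow, one_pow]
    field_simp
    ring
  rw [e]
  linarith

end AdmissibleRecip

open AdmissibleRecip in
theorem hasSummableSlopes_of_omega {f : ℝ → ℝ} {w : ℂ → ℂ} (hw : w ∈ Omega0) {c : ℝ} (hc : 0 ≤ c)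
    (h : ∀ t : ℝ, 0 < t → f t ≤ c + Real.log ‖w (t : ℂ)‖) : HasSummableSlopes f := by
  obtain ⟨τ, hτ, hprod⟩ := hw
  have hρ := hτ.admissibleRecip
  have hf : ∀ t : ℝ, 0 < t → f t ≤ c + logProd (recip τ) t := fun t ht =>
    (h t ht).trans (by linarith [hρ.log_norm_le_logProd ht.le (hprod t)])
  have h1 := logProd_nonneg (recip τ) 1
  refine ⟨c + logProd (recip τ) 1, fun k => 8 * (logProd (recip τ) (4 ^ (k + 1)) / 4 ^ (k + 1))
    + (1 / 4) ^ k, by positivity, fun k => ?_, ?_, fun t ht ht1 => ?_, fun k t hkt => ?_⟩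
  · have := logProd_nonneg (recip τ) (4 ^ (k + 1))
    positivity
  · have hs := (summable_nat_add_iff (f := fun k : ℕ => logProd (recip τ) (4 ^ k) / 4 ^ k) 1).2
      hρ.summable_logProd_div
    exact (hs.mul_left 8).add (summable_geometric_of_lt_one (by norm_num) (by norm_num))
  · linarith [hf t ht, hρ.logProd_mono ht.le ht1]
  · linarith [hf t (lt_of_lt_of_le (by positivity) hkt), hρ.logProd_le_slope k hkt]

/-! ### Decreasing slopes and the smooth concave majorant. -/

/-- Antitone summable sequences that do not decay faster than `2 ^ (-k)`. -/
structure SlopeSeq (G : ℕ → ℝ) : Prop where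
  anti : Antitone G
  summable : Summable G
  lower : ∀ k, (1 / 2 : ℝ) ^ k ≤ G k

theorem HasSummableSlopes.exists_slopeSeq {f : ℝ → ℝ} (hf : HasSummableSlopes f) :
    ∃ (c : ℝ) (G : ℕ → ℝ), 0 ≤ c ∧ SlopeSeq G ∧ (∀ t, 0 < t → t ≤ 1 → f t ≤ c) ∧
      ∀ k t, (4 : ℝ) ^ k ≤ t → f t ≤ c + t * G k := by
  obtain ⟨c, H, hc, hH, hs, h1, h2⟩ := hf
  set M : ℕ → ℝ := fun k => (Finset.range (k + 1)).inf' Finset.nonempty_range_add_one H with hM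
  have hM0 : ∀ k, 0 ≤ M k := fun k => Finset.le_inf' _ _ fun i _ => hH i
  have hMH : ∀ k, M k ≤ H k := fun k => Finset.inf'_le _ (Finset.self_mem_range_succ k)
  -- The bound with `H i` persists for all larger `t`, so the running minimum of `H` is also a valid
  -- slope. The added `(1 / 2) ^ k` later makes `concaveHull` unbounded.
  refine ⟨c, fun k => M k + (1 / 2) ^ k, hc, ⟨?_, ?_, fun k => by linarith [hM0 k]⟩, h1, ?_⟩
  · intro i j hij
    have e1 : M j ≤ M i := Finset.inf'_mono _ (Finset.range_mono (by omega)) _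
    have e2 : (1 / 2 : ℝ) ^ j ≤ (1 / 2) ^ i :=
      pow_le_pow_of_le_one (by norm_num) (by norm_num) hij
    simp only
    linarith
  · exact (Summable.of_nonneg_of_le hM0 hMH hs).add summable_geometric_two
  · intro k t hkt
    have ht : 0 < t := lt_of_lt_of_le (by positivity) hkt
    obtain ⟨i, hi, he⟩ := Finset.exists_mem_eq_inf' Finset.nonempty_range_add_one
      (s := Finset.range (k + 1)) H
    have hik : i ≤ k := Nat.lt_succ_iff.1 (Finset.mem_range.1 hi)
    have h3 := h2 i t ((pow_le_pow_right₀ (by norm_num) hik).trans hkt)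
    have h4 : M k = H i := he
    have h5 : 0 ≤ t * (1 / 2) ^ k := by positivity
    simp only [h4]
    linarith

theorem exists_pow_four_near {t : ℝ} (ht : 1 ≤ t) : ∃ k : ℕ, (4 : ℝ) ^ k ≤ t ∧ t < 4 ^ (k + 1) :=
  exists_nat_pow_near ht (by norm_num)

namespace SlopeSeq

variable {G : ℕ → ℝ}

theorem pos (h : SlopeSeq G) (k : ℕ) : 0 < G k := lt_of_lt_of_le (by positivity) (h.lower k)

theorem diff_nonneg (h : SlopeSeq G) (i : ℕ) : 0 ≤ G i - G (i + 1) :=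
  sub_nonneg.2 (h.anti (Nat.le_succ i))

theorem hasSum_diff (h : SlopeSeq G) (k : ℕ) :
    HasSum (fun i => G (i + k) - G (i + k + 1)) (G k) := by
  refine (hasSum_iff_tendsto_nat_of_nonneg (fun i => h.diff_nonneg (i + k)) _).2 ?_
  have e : ∀ n, ∑ i ∈ Finset.range n, (G (i + k) - G (i + k + 1)) = G k - G (n + k) := by
    intro n
    have := Finset.sum_range_sub' (fun i => G (i + k)) n
    simp only [zero_add] at this
    rw [← this]
    refine Finset.sum_congr rfl fun i _ => ?_
    rw [add_right_comm]
  simp only [e]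
  simpa using ((tendsto_add_atTop_iff_nat k).2 h.summable.tendsto_atTop_zero).const_sub (G k)

theorem summable_diff (h : SlopeSeq G) : Summable fun i => G i - G (i + 1) :=
  (h.hasSum_diff 0).summable

/-- By monotonicity `k * G k` is at most twice the sum of `G` from `k / 2` to `k - 1`, hence at most
twice a tail of the series. -/
theorem tendsto_mul_zero (h : SlopeSeq G) :
    Tendsto (fun k : ℕ => ((k : ℝ) + 1) * G k) atTop (𝓝 0) := by
  have hT : Tendsto (fun m : ℕ => 2 * (∑' i, G i - ∑ i ∈ Finset.range m, G i)) atTop (𝓝 0) := by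
    simpa using (h.summable.hasSum.tendsto_sum_nat.const_sub (∑' i, G i)).const_mul 2
  have hdiv : Tendsto (fun k : ℕ => k / 2) atTop atTop :=
    Nat.tendsto_div_const_atTop (by norm_num)
  have hlim := (hT.comp hdiv).add h.summable.tendsto_atTop_zero
  rw [add_zero] at hlim
  refine squeeze_zero (fun k => mul_nonneg (by positivity) (h.pos k).le) (fun k => ?_) hlim
  have h1 : ∑ i ∈ Finset.range k, G i ≤ ∑' i, G i :=
    h.summable.sum_le_tsum _ fun i _ => (h.pos i).le
  have h2 : ∑ i ∈ Finset.range k, G i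
      = ∑ i ∈ Finset.range (k / 2), G i + ∑ i ∈ Finset.range (k - k / 2), G (k / 2 + i) := by
    rw [← Finset.sum_range_add, Nat.add_sub_of_le (Nat.div_le_self k 2)]
  have h3 : ((k - k / 2 : ℕ) : ℝ) * G k ≤ ∑ i ∈ Finset.range (k - k / 2), G (k / 2 + i) := by
    have := Finset.card_nsmul_le_sum (Finset.range (k - k / 2)) (fun i => G (k / 2 + i)) (G k)
      fun i hi => h.anti (by have := Finset.mem_range.1 hi; omega)
    simpa [nsmul_eq_mul] using this
  have h4 : (k : ℝ) ≤ 2 * ((k - k / 2 : ℕ) : ℝ) := by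
    have : k ≤ 2 * (k - k / 2) := by omega
    exact_mod_cast this
  have h5 := mul_le_mul_of_nonneg_right h4 (h.pos k).le
  simp only [Function.comp]
  linarith

/-- The quotient `concaveHull G t / t`, up to its constant factor. -/
noncomputable def slopeAvg (G : ℕ → ℝ) (t : ℝ) : ℝ :=
  ∑' i : ℕ, (G i - G (i + 1)) / (1 + t / 4 ^ i)

/-- The smooth concave function that majorizes `t * G k` on `[4 ^ k, 4 ^ (k + 1)]`. -/
noncomputable def concaveHull (G : ℕ → ℝ) (t : ℝ) : ℝ := 5 * (t * slopeAvg G t)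

theorem summable_slope (h : SlopeSeq G) {t : ℝ} (ht : 0 ≤ t) :
    Summable fun i : ℕ => (G i - G (i + 1)) / (1 + t / 4 ^ i) :=
  Summable.of_nonneg_of_le (fun i => div_nonneg (h.diff_nonneg i) (by positivity))
    (fun i => div_le_self (h.diff_nonneg i) (by linarith [show 0 ≤ t / 4 ^ i by positivity]))
    h.summable_diff

theorem slopeAvg_nonneg (h : SlopeSeq G) {t : ℝ} (ht : 0 ≤ t) : 0 ≤ slopeAvg G t :=
  tsum_nonneg fun i => div_nonneg (h.diff_nonneg i) (by positivity)

theorem concaveHull_nonneg (h : SlopeSeq G) {t : ℝ} (ht : 0 ≤ t) : 0 ≤ concaveHull G t :=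
  mul_nonneg (by norm_num) (mul_nonneg ht (h.slopeAvg_nonneg ht))

theorem slopeAvg_anti (h : SlopeSeq G) {s t : ℝ} (hs : 0 ≤ s) (hst : s ≤ t) :
    slopeAvg G t ≤ slopeAvg G s :=
  (h.summable_slope (hs.trans hst)).tsum_le_tsum (fun i => by
    have := h.diff_nonneg i
    gcongr) (h.summable_slope hs)

theorem concaveHull_le (h : SlopeSeq G) {t : ℝ} (ht : 0 ≤ t) : concaveHull G t ≤ 5 * G 0 * t := by
  have h1 := h.slopeAvg_anti le_rfl ht
  have h2 : slopeAvg G 0 = G 0 := by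
    simp only [slopeAvg, zero_div, add_zero, div_one]
    exact (h.hasSum_diff 0).tsum_eq
  rw [h2] at h1
  unfold concaveHull
  nlinarith

theorem le_concaveHull (h : SlopeSeq G) {k : ℕ} {t : ℝ} (ht : 0 ≤ t) (htk : t ≤ 4 ^ (k + 1)) :
    t * G k ≤ concaveHull G t := by
  have hs := h.summable_slope ht
  have h1 : ∑' i, (G (i + k) - G (i + k + 1)) / (1 + t / 4 ^ (i + k)) ≤ slopeAvg G t := by
    rw [slopeAvg, ← hs.sum_add_tsum_nat_add k]
    exact le_add_of_nonneg_left
      (Finset.sum_nonneg fun i _ => div_nonneg (h.diff_nonneg i) (by positivity))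
  have h2 : G k / 5 ≤ ∑' i, (G (i + k) - G (i + k + 1)) / (1 + t / 4 ^ (i + k)) := by
    rw [← (h.hasSum_diff k).tsum_eq, ← tsum_div_const]
    refine ((h.hasSum_diff k).summable.div_const 5).tsum_le_tsum (fun i => ?_)
      ((summable_nat_add_iff (f := fun i : ℕ => (G i - G (i + 1)) / (1 + t / 4 ^ i)) k).2 hs)
    -- Only the indices from `k` on are kept. Their denominators are at most `1 + 4`, whence the
    -- factor `5` in `concaveHull`; their numerators telescope to `G k`.
    have h3 : t / 4 ^ (i + k) ≤ 4 := by
      rw [div_le_iff₀ (by positivity)]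
      refine htk.trans ?_
      rw [pow_succ, mul_comm]
      gcongr
      · norm_num
      · omega
    have := h.diff_nonneg (i + k)
    gcongr
    linarith
  unfold concaveHull
  nlinarith

theorem concaveHull_eq_tsum (G : ℕ → ℝ) (t : ℝ) :
    concaveHull G t = ∑' i : ℕ, 5 * (G i - G (i + 1)) * (t / (1 + t / 4 ^ i)) := by
  rw [concaveHull, slopeAvg, ← tsum_mul_left, ← tsum_mul_left]
  exact tsum_congr fun i => by ring

theorem summable_concaveHull (h : SlopeSeq G) {t : ℝ} (ht : 0 ≤ t) :
    Summable fun i : ℕ => 5 * (G i - G (i + 1)) * (t / (1 + t / 4 ^ i)) :=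
  ((h.summable_slope ht).mul_left (5 * t)).congr fun i => by ring

theorem concaveHull_mono (h : SlopeSeq G) {s t : ℝ} (hs : 0 ≤ s) (hst : s ≤ t) :
    concaveHull G s ≤ concaveHull G t := by
  rw [concaveHull_eq_tsum, concaveHull_eq_tsum]
  refine (h.summable_concaveHull hs).tsum_le_tsum (fun i => ?_)
    (h.summable_concaveHull (hs.trans hst))
  have ht : 0 ≤ t := hs.trans hst
  refine mul_le_mul_of_nonneg_left ?_ (by linarith [h.diff_nonneg i])
  rw [div_le_div_iff₀ (by positivity) (by positivity)]
  ring_nf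
  linarith

theorem div_one_add_concave {a s t x y : ℝ} (ha : 0 < a) (hs : 0 ≤ s) (ht : 0 ≤ t) (hx : 0 ≤ x)
    (hy : 0 ≤ y) (hxy : x + y = 1) :
    x * (s / (1 + s / a)) + y * (t / (1 + t / a))
      ≤ (x * s + y * t) / (1 + (x * s + y * t) / a) := by
  have e : ∀ u, 0 ≤ u → u / (1 + u / a) = a * u / (a + u) := fun u hu => by field_simp
  rw [e s hs, e t ht, e (x * s + y * t) (by positivity)]
  obtain rfl : y = 1 - x := by linarith
  have hd : a * (x * s + (1 - x) * t) / (a + (x * s + (1 - x) * t))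
      - (x * (a * s / (a + s)) + (1 - x) * (a * t / (a + t)))
      = a ^ 2 * (x * (1 - x)) * (s - t) ^ 2
        / ((a + s) * (a + t) * (a + (x * s + (1 - x) * t))) := by
    have h1 : a + s ≠ 0 := by positivity
    have h2 : a + t ≠ 0 := by positivity
    have h3 : a + (x * s + (1 - x) * t) ≠ 0 := by positivity
    field_simp
    ring
  have : 0 ≤ a ^ 2 * (x * (1 - x)) * (s - t) ^ 2
        / ((a + s) * (a + t) * (a + (x * s + (1 - x) * t))) := by positivity
  linarith

theorem concaveOn_concaveHull (h : SlopeSeq G) : ConcaveOn ℝ (Ioi 0) (concaveHull G) := by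
  refine ⟨convex_Ioi 0, fun s hs t ht x y hx hy hxy => ?_⟩
  have hs' : (0 : ℝ) ≤ s := le_of_lt hs
  have ht' : (0 : ℝ) ≤ t := le_of_lt ht
  simp only [smul_eq_mul, concaveHull_eq_tsum]
  rw [← tsum_mul_left, ← tsum_mul_left, ← Summable.tsum_add
    ((h.summable_concaveHull hs').mul_left x) ((h.summable_concaveHull ht').mul_left y)]
  refine Summable.tsum_le_tsum (fun i => ?_) (((h.summable_concaveHull hs').mul_left x).add
    ((h.summable_concaveHull ht').mul_left y)) (h.summable_concaveHull (by positivity))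
  have := mul_le_mul_of_nonneg_left
    (div_one_add_concave (a := 4 ^ i) (by positivity) hs' ht' hx hy hxy)
    (show 0 ≤ 5 * (G i - G (i + 1)) by linarith [h.diff_nonneg i])
  linarith

/-- The series for `slopeAvg` converges normally to a holomorphic function on the right half-plane,
so smoothness needs no termwise differentiation. -/
theorem contDiffOn_concaveHull (h : SlopeSeq G) : ContDiffOn ℝ ∞ (concaveHull G) (Ioi 0) := by
  set U : Set ℂ := {z | 0 < z.re} with hU
  have hUo : IsOpen U := isOpen_lt continuous_const Complex.continuous_re
  set F : ℂ → ℂ := fun z => ∑' i : ℕ, ((G i - G (i + 1) : ℝ) : ℂ) / (1 + z / 4 ^ i) with hF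
  have hre : ∀ (i : ℕ) (z : ℂ), z ∈ U → 1 ≤ ‖1 + z / 4 ^ i‖ := by
    intro i z hz
    refine le_trans ?_ (Complex.re_le_norm _)
    have e : (z / 4 ^ i).re = z.re / 4 ^ i := by
      have := Complex.div_ofReal_re z (4 ^ i)
      push_cast at this
      exact this
    rw [Complex.add_re, Complex.one_re, e]
    have : 0 < z.re := hz
    have : 0 ≤ z.re / 4 ^ i := by positivity
    linarith
  have hd : DifferentiableOn ℂ F U := by
    refine Complex.differentiableOn_tsum_of_summable_norm h.summable_diff (fun i z hz => ?_) hUo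
      fun i z hz => ?_
    · have hne : 1 + z / 4 ^ i ≠ 0 := norm_pos_iff.1 (lt_of_lt_of_le one_pos (hre i z hz))
      have : DifferentiableAt ℂ (fun z : ℂ => 1 + z / 4 ^ i) z := by fun_prop
      exact ((differentiableAt_const _).div this hne).differentiableWithinAt
    · rw [norm_div, Complex.norm_real, Real.norm_of_nonneg (h.diff_nonneg i)]
      exact div_le_self (h.diff_nonneg i) (hre i z hz)
  have hc : ContDiffOn ℝ ∞ F U := (hd.contDiffOn hUo).restrict_scalars ℝ
  have hc2 : ContDiffOn ℝ ∞ (fun t : ℝ => (F (t : ℂ)).re) (Ioi 0) :=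
    Complex.reCLM.contDiff.comp_contDiffOn
      (hc.comp Complex.ofRealCLM.contDiff.contDiffOn fun t ht => by simpa [hU] using ht)
  have e : ∀ t : ℝ, (F (t : ℂ)).re = slopeAvg G t := by
    intro t
    have : F (t : ℂ) = (slopeAvg G t : ℂ) := by
      rw [slopeAvg, Complex.ofReal_tsum]
      simp only [hF]
      push_cast
      rfl
    rw [this, Complex.ofReal_re]
  simp only [e] at hc2
  exact contDiffOn_const.mul (contDiffOn_id.mul hc2)

theorem summable_index_mul_diff (h : SlopeSeq G) :
    Summable fun i : ℕ => ((i : ℝ) + 1) * (G i - G (i + 1)) := by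
  have e : ∀ n : ℕ, ∑ i ∈ Finset.range n, ((i : ℝ) + 1) * (G i - G (i + 1))
      = ∑ i ∈ Finset.range n, G i - n * G n := by
    intro n
    induction n with
    | zero => simp
    | succ n ih =>
      rw [Finset.sum_range_succ, Finset.sum_range_succ, ih]
      push_cast
      ring
  refine summable_of_sum_range_le (c := ∑' i, G i)
    (fun i => mul_nonneg (by positivity) (h.diff_nonneg i)) fun n => ?_
  have h1 : ∑ i ∈ Finset.range n, G i ≤ ∑' i, G i :=
    h.summable.sum_le_tsum _ fun i _ => (h.pos i).le
  have h2 : 0 ≤ (n : ℝ) * G n := mul_nonneg (by positivity) (h.pos n).le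
  rw [e]
  linarith

/-- For `a = 4 ^ i` this logarithm is at most `(i + 1) * ln 4`, the weight matched by
`summable_index_mul_diff`. -/
theorem integral_kernel {a : ℝ} (ha : 0 < a) :
    IntegrableOn (fun t : ℝ => 1 / (t * (1 + t / a))) (Ioi 1) ∧
      ∫ t in Ioi (1 : ℝ), 1 / (t * (1 + t / a)) = Real.log (1 + a) := by
  have hderiv : ∀ x ∈ Ici (1 : ℝ), HasDerivAt (fun t => -Real.log (1 + a / t))
      (1 / (x * (1 + x / a))) x := by
    intro x hx
    have hx0 : 0 < x := lt_of_lt_of_le one_pos hx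
    have h1 : HasDerivAt (fun t : ℝ => 1 + a / t) (-a / x ^ 2) x := by
      have := ((hasDerivAt_inv hx0.ne').const_mul a).const_add 1
      simpa [div_eq_mul_inv] using this
    have h2 := (h1.log (by positivity)).neg
    refine h2.congr_deriv ?_
    field_simp
    ring
  have hpos : ∀ x ∈ Ioi (1 : ℝ), 0 ≤ 1 / (x * (1 + x / a)) := by
    intro x hx
    have hx0 : 0 < x := lt_trans one_pos hx
    positivity
  have hlim : Tendsto (fun t => -Real.log (1 + a / t)) atTop (𝓝 0) := by
    have h1 : Tendsto (fun t : ℝ => 1 + a / t) atTop (𝓝 1) := by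
      simpa using (tendsto_const_nhds (x := a)).div_atTop tendsto_id |>.const_add 1
    simpa using (h1.log one_ne_zero).neg
  refine ⟨integrableOn_Ioi_deriv_of_nonneg' hderiv hpos hlim, ?_⟩
  rw [integral_Ioi_of_hasDerivAt_of_nonneg' hderiv hpos hlim]
  simp

theorem integrableOn_concaveHull (h : SlopeSeq G) :
    IntegrableOn (fun t => concaveHull G t / t ^ 2) (Ioi 1) := by
  have hcont : ContinuousOn (fun t => concaveHull G t / t ^ 2) (Ioi 1) := by
    have h1 : ContinuousOn (concaveHull G) (Ioi 1) :=
      h.contDiffOn_concaveHull.continuousOn.mono (Ioi_subset_Ioi zero_le_one)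
    refine h1.div (by fun_prop) fun t ht => ?_
    have : (0 : ℝ) < t := lt_trans one_pos ht
    positivity
  refine ⟨hcont.aestronglyMeasurable measurableSet_Ioi, ?_⟩
  set F : ℕ → ℝ → ℝ := fun i t => 5 * (G i - G (i + 1)) * (1 / (t * (1 + t / 4 ^ i))) with hF
  have hγ : ∀ i, 0 ≤ 5 * (G i - G (i + 1)) := fun i => by linarith [h.diff_nonneg i]
  have hF0 : ∀ i, ∀ t ∈ Ioi (1 : ℝ), 0 ≤ F i t := by
    intro i t ht
    have : (0 : ℝ) < t := lt_trans one_pos ht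
    exact mul_nonneg (hγ i) (by positivity)
  have hFint : ∀ i, ∫⁻ t in Ioi (1 : ℝ), ENNReal.ofReal (F i t)
      = ENNReal.ofReal (5 * (G i - G (i + 1)) * Real.log (1 + 4 ^ i)) := by
    intro i
    obtain ⟨hi, he⟩ := integral_kernel (a := 4 ^ i) (by positivity)
    rw [← he, ← integral_const_mul, ofReal_integral_eq_lintegral_ofReal (hi.const_mul _)]
    filter_upwards [ae_restrict_mem measurableSet_Ioi] with t ht
    exact hF0 i t ht
  have hFeq : ∀ t ∈ Ioi (1 : ℝ), ‖concaveHull G t / t ^ 2‖ₑ = ∑' i, ENNReal.ofReal (F i t) := by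
    intro t ht
    have ht0 : (0 : ℝ) < t := lt_trans one_pos ht
    have e : ∀ i, 5 * (G i - G (i + 1)) * (t / (1 + t / 4 ^ i)) / t ^ 2 = F i t := by
      intro i
      simp only [hF]
      field_simp
    have hs := (h.summable_concaveHull ht0.le).div_const (t ^ 2)
    simp only [e] at hs
    rw [Real.enorm_of_nonneg (div_nonneg (h.concaveHull_nonneg ht0.le) (by positivity)),
      concaveHull_eq_tsum, ← tsum_div_const, ← ENNReal.ofReal_tsum_of_nonneg
        (fun i => hF0 i t ht) hs]
    simp only [e]
  have hFm : ∀ i, Measurable (F i) := fun i => by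
    simp only [hF]
    fun_prop
  have hsum : Summable fun i : ℕ => 5 * (G i - G (i + 1)) * Real.log (1 + 4 ^ i) := by
    refine Summable.of_nonneg_of_le (fun i => mul_nonneg (hγ i) (Real.log_nonneg ?_)) (fun i => ?_)
      (h.summable_index_mul_diff.mul_left (5 * Real.log 4))
    · linarith [show (0 : ℝ) ≤ 4 ^ i by positivity]
    · have h1 : Real.log (1 + 4 ^ i) ≤ (i + 1) * Real.log 4 := by
        have := Real.log_le_log (by positivity : (0 : ℝ) < 1 + 4 ^ i)
          (show (1 : ℝ) + 4 ^ i ≤ 4 ^ (i + 1) by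
            rw [pow_succ]
            linarith [one_le_pow₀ (show (1 : ℝ) ≤ 4 by norm_num) (n := i)])
        rw [Real.log_pow] at this
        push_cast at this
        exact this
      have := mul_le_mul_of_nonneg_left h1 (hγ i)
      linarith
  rw [HasFiniteIntegral, setLIntegral_congr_fun measurableSet_Ioi hFeq,
    lintegral_tsum fun i => (hFm i).ennreal_ofReal.aemeasurable]
  simp only [hFint]
  rw [← ENNReal.ofReal_tsum_of_nonneg (fun i => mul_nonneg (hγ i) (Real.log_nonneg ?_)) hsum]
  · exact ENNReal.ofReal_lt_top
  · linarith [show (0 : ℝ) ≤ 4 ^ i by positivity]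

end SlopeSeq

/-! ### The limit at infinity and the smooth majorant of `f`. -/

theorem HasSummableSlopes.tendsto_mul_log_div {f : ℝ → ℝ} (hf : HasSummableSlopes f)
    (hpos : PosOnPos f) : Tendsto (fun t : ℝ => f t * Real.log t / t) atTop (𝓝 0) := by
  obtain ⟨c, G, hc, hG, -, hk⟩ := hf.exists_slopeSeq
  have hlog : Tendsto (fun t : ℝ => c * (Real.log t / t)) atTop (𝓝 0) := by
    have := (Real.isLittleO_log_id_atTop.tendsto_div_nhds_zero).const_mul c
    simpa using this
  have hl4 : 0 < Real.log 4 := Real.log_pos (by norm_num)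
  rw [tendsto_order]
  refine ⟨fun a ha => ?_, fun ε hε => ?_⟩
  · filter_upwards [eventually_ge_atTop 1] with t ht
    have h0 : 0 < t := by linarith
    exact lt_of_lt_of_le ha
      (div_nonneg (mul_nonneg (hpos t h0).le (Real.log_nonneg ht)) h0.le)
  · have h1 := (hG.tendsto_mul_zero.const_mul (Real.log 4)).eventually_lt_const
      (show Real.log 4 * 0 < ε / 2 by linarith)
    obtain ⟨K, hK⟩ := eventually_atTop.1 h1
    filter_upwards [eventually_ge_atTop ((4 : ℝ) ^ K), eventually_ge_atTop (1 : ℝ),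
      hlog.eventually_lt_const (show (0 : ℝ) < ε / 2 by linarith)] with t ht ht1 hct
    obtain ⟨k, hk1, hk2⟩ := exists_pow_four_near ht1
    have hKk : K ≤ k := by
      have := (pow_lt_pow_iff_right₀ (show (1 : ℝ) < 4 by norm_num)).1 (ht.trans_lt hk2)
      omega
    have h0 : 0 < t := by linarith
    -- On `[4 ^ k, 4 ^ (k + 1))` this turns `G k * ln t` into a multiple of `(k + 1) * G k`, which
    -- tends to `0`.
    have hlt : Real.log t ≤ (k + 1) * Real.log 4 := by
      have := Real.log_le_log h0 hk2.le
      rw [Real.log_pow] at this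
      push_cast at this
      exact this
    have h2 : f t * Real.log t / t ≤ c * (Real.log t / t) + G k * Real.log t := by
      have := mul_le_mul_of_nonneg_right (hk k t hk1) (Real.log_nonneg ht1)
      calc _ ≤ (c + t * G k) * Real.log t / t := by gcongr
        _ = _ := by field_simp
    have h3 := mul_le_mul_of_nonneg_left hlt (hG.pos k).le
    have h4 := hK k hKk
    linarith

theorem HasSummableSlopes.exists_smooth_concave {f : ℝ → ℝ} (hf : HasSummableSlopes f) :
    ∃ α : ℝ → ℝ, PosOnPos α ∧ ContDiffOn ℝ ∞ α (Ioi 0) ∧ MonotoneOn α (Ioi 0) ∧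
      ConcaveOn ℝ (Ioi 0) α ∧ NonQuasianalytic α ∧ MajorizedBy f α := by
  obtain ⟨c, G, hc, hG, h1, hk⟩ := hf.exists_slopeSeq
  have hcd : ContDiffOn ℝ ∞ (fun t => (c + 1) + SlopeSeq.concaveHull G t) (Ioi 0) :=
    contDiffOn_const.add hG.contDiffOn_concaveHull
  refine ⟨fun t => (c + 1) + SlopeSeq.concaveHull G t, fun t ht => ?_, hcd, fun s hs t _ hst => ?_,
    (concaveOn_const (c + 1) (convex_Ioi 0)).add hG.concaveOn_concaveHull,
    ⟨hcd.continuousOn.aemeasurable measurableSet_Ioi, ?_⟩, fun t ht => ?_⟩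
  · linarith [hG.concaveHull_nonneg ht.le]
  · linarith [hG.concaveHull_mono (le_of_lt hs) hst]
  · have h2 : IntegrableOn (fun t : ℝ => (c + 1) / t ^ 2) (Ioi 1) := by
      have h3 : IntegrableOn (fun t : ℝ => (c + 1) * t ^ (-2 : ℝ)) (Ioi 1) :=
        (integrableOn_Ioi_rpow_of_lt (by norm_num) one_pos).const_mul (c + 1)
      refine h3.congr_fun (fun t ht => ?_) measurableSet_Ioi
      have h0 : (0 : ℝ) < t := lt_trans one_pos ht
      simp only
      rw [Real.rpow_neg h0.le, Real.rpow_two, div_eq_mul_inv]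
    refine (h2.add hG.integrableOn_concaveHull).congr_fun (fun t _ => ?_) measurableSet_Ioi
    simp only [Pi.add_apply]
    ring
  · rcases le_total t 1 with h | h
    · linarith [h1 t ht h, hG.concaveHull_nonneg ht.le]
    · obtain ⟨k, hk1, hk2⟩ := exists_pow_four_near h
      linarith [hk k t hk1, hG.le_concaveHull ht.le hk2.le]

/-! ### From subadditivity to summable slopes. -/

theorem SubadditiveOnPos.nsmul_le {α : ℝ → ℝ} (h : SubadditiveOnPos α) {u : ℝ} (hu : 0 < u) {n : ℕ}
    (hn : 1 ≤ n) : α (n * u) ≤ n * α u := by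
  induction n, hn using Nat.le_induction with
  | base => simp
  | succ n hn ih =>
    have hn' : (0 : ℝ) < n := by exact_mod_cast hn
    have := h (n * u) u (by positivity) hu
    push_cast
    rw [add_mul, one_mul, add_mul, one_mul]
    linarith

/-- Integrate `α u ≤ α s + α (u - s)` over `[u / 4, 3 * u / 4]`, which is invariant under `s ↦ u -
s`, and use `s ≤ u` to insert the weight `u ^ 2 / s ^ 2`. The condition `4 ≤ u` keeps the interval
inside `[1, ∞)`. -/
theorem SubadditiveOnPos.le_integral {α : ℝ → ℝ} (h : SubadditiveOnPos α) (hpos : PosOnPos α)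
    (hint : IntegrableOn (fun t : ℝ => α t / t ^ 2) (Ioi (1 : ℝ))) {u : ℝ} (hu : 4 ≤ u) :
    α u ≤ u * (4 * ∫ s in (u / 4)..(3 * u / 4), α s / s ^ 2) := by
  have hle : u / 4 ≤ 3 * u / 4 := by linarith
  have hi : IntervalIntegrable (fun s => α s / s ^ 2) volume (u / 4) (3 * u / 4) :=
    (intervalIntegrable_iff_integrableOn_Ioc_of_le hle).2
      (hint.mono_set fun s hs => lt_of_le_of_lt (by linarith) hs.1)
  have hα : IntervalIntegrable α volume (u / 4) (3 * u / 4) := by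
    have h1 : IntervalIntegrable (fun s => s ^ 2 * (α s / s ^ 2)) volume (u / 4) (3 * u / 4) :=
      hi.continuousOn_mul (by fun_prop)
    refine IntervalIntegrable.congr (fun s hs => ?_) h1
    rw [uIoc_of_le hle] at hs
    have : 0 < s := by linarith [hs.1]
    field_simp
  have hα' : IntervalIntegrable (fun s => α (u - s)) volume (u / 4) (3 * u / 4) := by
    have := (hα.comp_sub_left u).symm
    convert this using 1 <;> ring
  have h1 : ∫ _ in (u / 4)..(3 * u / 4), α u
      ≤ ∫ s in (u / 4)..(3 * u / 4), (α s + α (u - s)) := by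
    refine intervalIntegral.integral_mono_on hle intervalIntegrable_const (hα.add hα')
      fun s hs => ?_
    have := h s (u - s) (by linarith [hs.1]) (by linarith [hs.2])
    rwa [add_sub_cancel] at this
  rw [intervalIntegral.integral_const, intervalIntegral.integral_add hα hα',
    intervalIntegral.integral_comp_sub_left, smul_eq_mul, show u - 3 * u / 4 = u / 4 by ring,
    show u - u / 4 = 3 * u / 4 by ring] at h1
  have h2 : ∫ s in (u / 4)..(3 * u / 4), α s
      ≤ ∫ s in (u / 4)..(3 * u / 4), u ^ 2 * (α s / s ^ 2) := by
    refine intervalIntegral.integral_mono_on hle hα (hi.const_mul _) fun s hs => ?_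
    have hs0 : 0 < s := by linarith [hs.1]
    have := hpos s hs0
    rw [← mul_div_assoc, le_div_iff₀ (by positivity), mul_comm]
    gcongr
    linarith [hs.2]
  rw [intervalIntegral.integral_const_mul] at h2
  have h3 : u / 2 * α u ≤ u / 2 * (u * (4 * ∫ s in (u / 4)..(3 * u / 4), α s / s ^ 2)) := by
    linarith
  exact le_of_mul_le_mul_left h3 (by linarith)

theorem hasSummableSlopes_of_subadditive {f α : ℝ → ℝ} (hpos : PosOnPos α)
    (hsub : SubadditiveOnPos α) (hbdd : BoundedNearZero α)
    (hint : IntegrableOn (fun t : ℝ => α t / t ^ 2) (Ioi (1 : ℝ))) (hf : MajorizedBy f α) :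
    HasSummableSlopes f := by
  obtain ⟨C, hC⟩ := hbdd
  have hC' : ∀ t, 0 < t → t ≤ 1 → α t ≤ C := fun t h0 h1 => (le_abs_self _).trans (hC t h0 h1)
  have hC0 : 0 < C := (hpos 1 one_pos).trans_le (hC' 1 one_pos le_rfl)
  have hii : ∀ x y : ℝ, 1 ≤ x → x ≤ y → IntervalIntegrable (fun s => α s / s ^ 2) volume x y :=
    fun x y hx hxy => (intervalIntegrable_iff_integrableOn_Ioc_of_le hxy).2
      (hint.mono_set fun s hs => lt_of_le_of_lt hx hs.1)
  set I : ℕ → ℝ := fun k => ∫ s in ((4 : ℝ) ^ k)..(4 ^ (k + 1)), α s / s ^ 2 with hI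
  have h4 : ∀ k : ℕ, (1 : ℝ) ≤ 4 ^ k := fun k => one_le_pow₀ (by norm_num)
  have h44 : ∀ k : ℕ, (4 : ℝ) ^ k ≤ 4 ^ (k + 1) := fun k =>
    pow_le_pow_right₀ (by norm_num) (Nat.le_succ k)
  have hnn : ∀ s : ℝ, 0 < s → 0 ≤ α s / s ^ 2 := fun s hs =>
    div_nonneg (hpos s hs).le (by positivity)
  have hI0 : ∀ k, 0 ≤ I k := fun k => intervalIntegral.integral_nonneg (h44 k)
    fun s hs => hnn s (lt_of_lt_of_le one_pos ((h4 k).trans hs.1))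
  have hIs : Summable I := by
    refine summable_of_sum_range_le (c := ∫ s in Ioi (1 : ℝ), α s / s ^ 2) hI0 fun n => ?_
    have e := intervalIntegral.sum_integral_adjacent_intervals (f := fun s => α s / s ^ 2)
      (μ := volume) (a := fun k : ℕ => (4 : ℝ) ^ k) (n := n) fun k _ => hii _ _ (h4 k) (h44 k)
    simp only [hI]
    rw [e, intervalIntegral.integral_of_le (by simpa using h4 n)]
    refine setIntegral_mono_set hint ?_ (LE.le.eventuallyLE fun s hs => by simpa using hs.1)
    filter_upwards [ae_restrict_mem measurableSet_Ioi] with s hs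
    exact hnn s (lt_trans one_pos hs)
  -- For `u` in `[4 ^ (k + 1), 2 * 4 ^ (k + 1)]` the averaging interval lies in `[4 ^ k, 4 ^ (k +
  -- 2)]`, hence `I k + I (k + 1)`. On `[1, 2]` one halving reaches `(0, 1]`, where `α ≤ C`.
  let H : ℕ → ℝ := fun k => Nat.casesOn k (2 * C) fun k => 4 * (I k + I (k + 1))
  have hH0 : H 0 = 2 * C := rfl
  have hH1 : ∀ k, H (k + 1) = 4 * (I k + I (k + 1)) := fun _ => rfl
  have hHs : Summable H := by
    rw [← summable_nat_add_iff 1]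
    exact (hIs.add ((summable_nat_add_iff 1).2 hIs)).mul_left 4
  refine ⟨C, H, hC0.le, fun k => ?_, hHs, fun t h0 h1 => (hf t h0).trans (hC' t h0 h1),
    fun k t hkt => ?_⟩
  · cases k with
    | zero => rw [hH0]; positivity
    | succ k => rw [hH1]; linarith [hI0 k, hI0 (k + 1)]
  · have ht0 : 0 < t := lt_of_lt_of_le (by positivity) hkt
    have hbase : ∀ u, (4 : ℝ) ^ k ≤ u → u ≤ 2 * 4 ^ k → α u ≤ u * H k := by
      intro u hu1 hu2
      cases k with
      | zero =>
        rw [hH0]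
        simp only [pow_zero, mul_one] at hu1 hu2
        have h1 := hsub.nsmul_le (u := u / 2) (by linarith) (n := 2) (by norm_num)
        push_cast at h1
        rw [mul_div_cancel₀ u (by norm_num)] at h1
        nlinarith [hC' (u / 2) (by linarith) (by linarith)]
      | succ k =>
        rw [hH1]
        rw [pow_succ] at hu1 hu2
        have hk := h4 k
        refine (hsub.le_integral hpos hint (by linarith)).trans ?_
        refine mul_le_mul_of_nonneg_left (mul_le_mul_of_nonneg_left ?_ (by norm_num)) (by linarith)
        simp only [hI]
        rw [intervalIntegral.integral_add_adjacent_intervals (hii _ _ (h4 k) (h44 k))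
          (hii _ _ (h4 _) (h44 _))]
        refine intervalIntegral.integral_mono_interval (by linarith) (by linarith)
          (by rw [pow_succ, pow_succ]; linarith) ?_ (hii _ _ hk ((h44 k).trans (h44 _)))
        filter_upwards [ae_restrict_mem measurableSet_Ioc] with s hs
        exact hnn s (by linarith [hs.1])
    have h1 : α t ≤ t * H k := by
      refine le_mul_of_nsmul_le (by positivity) (fun u hu1 hu2 n hn => ?_) hkt
      have hu0 : 0 < u := lt_of_lt_of_le (by positivity) hu1
      refine (hsub.nsmul_le hu0 hn).trans ?_
      rw [mul_assoc]
      exact mul_le_mul_of_nonneg_left (hbase u hu1 hu2) (by positivity)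
    linarith [hf t ht0]

/-! ### Concavity, decreasing quotient, subadditivity. -/

theorem antitoneOn_div_of_concaveOn {α : ℝ → ℝ} (hpos : PosOnPos α)
    (h : ConcaveOn ℝ (Ioi 0) α) : AntitoneOn (fun t : ℝ => α t / t) (Ioi 0) := by
  intro s hs t ht hst
  have hs0 : (0 : ℝ) < s := hs
  have ht0 : (0 : ℝ) < t := ht
  rcases hst.eq_or_lt with rfl | hlt
  · exact le_rfl
  -- Concavity would be applied between `0` and `t`, but `0` is outside the domain: start from `ε >
  -- 0`, drop the positive term in `α ε`, and let `ε → 0`.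
  have key : s / t * α t ≤ α s := by
    have hlim : Tendsto (fun ε : ℝ => (s - ε) / (t - ε) * α t) (𝓝[>] 0) (𝓝 (s / t * α t)) := by
      have : ContinuousAt (fun ε : ℝ => (s - ε) / (t - ε) * α t) 0 := by
        have : t - 0 ≠ 0 := by simpa using ht0.ne'
        fun_prop (disch := assumption)
      simpa using this.tendsto.mono_left nhdsWithin_le_nhds
    refine le_of_tendsto hlim ?_
    filter_upwards [Ioo_mem_nhdsGT hs0] with ε hε
    have h1 : 0 < t - ε := by linarith [hε.2]
    have h2 := h.2 (show ε ∈ Ioi (0 : ℝ) from hε.1) ht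
      (show 0 ≤ (t - s) / (t - ε) from div_nonneg (by linarith) h1.le)
      (show 0 ≤ (s - ε) / (t - ε) from div_nonneg (by linarith [hε.2]) h1.le)
      (by rw [← add_div]; rw [div_eq_one_iff_eq h1.ne']; ring)
    have e : ((t - s) / (t - ε)) • ε + ((s - ε) / (t - ε)) • t = s := by
      simp only [smul_eq_mul]
      field_simp
      ring
    rw [e, smul_eq_mul, smul_eq_mul] at h2
    have h3 : 0 ≤ (t - s) / (t - ε) * α ε :=
      mul_nonneg (div_nonneg (by linarith) h1.le) (hpos ε hε.1).le
    linarith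
  simp only
  rw [div_le_div_iff₀ ht0 hs0]
  rw [div_mul_eq_mul_div, div_le_iff₀ ht0] at key
  linarith

theorem subadditiveOnPos_of_antitoneOn_div {α : ℝ → ℝ}
    (h : AntitoneOn (fun t : ℝ => α t / t) (Ioi 0)) : SubadditiveOnPos α := by
  intro s t hs ht
  have h1 := h (show s ∈ Ioi 0 from hs) (show s + t ∈ Ioi 0 from add_pos hs ht) (by linarith)
  have h2 := h (show t ∈ Ioi 0 from ht) (show s + t ∈ Ioi 0 from add_pos hs ht) (by linarith)
  simp only at h1 h2
  rw [le_div_iff₀ hs] at h1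
  rw [le_div_iff₀ ht] at h2
  have e : α (s + t) = α (s + t) / (s + t) * s + α (s + t) / (s + t) * t := by field_simp
  linarith

/-! ### An admissible sequence from the level points of the concave majorant. -/

namespace SlopeSeq

variable {G : ℕ → ℝ}

/-- The first point at which `concaveHull G` reaches the level `j + 1`. -/
noncomputable def levelPoint (G : ℕ → ℝ) (j : ℕ) : ℝ :=
  sInf {t : ℝ | 0 < t ∧ (j : ℝ) + 1 ≤ concaveHull G t}

theorem levelSet_nonempty (h : SlopeSeq G) (j : ℕ) :
    {t : ℝ | 0 < t ∧ (j : ℝ) + 1 ≤ concaveHull G t}.Nonempty := by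
  obtain ⟨k, hk⟩ := pow_unbounded_of_one_lt ((j : ℝ) + 1) one_lt_two
  refine ⟨4 ^ k, by positivity, hk.le.trans ?_⟩
  have h1 := h.le_concaveHull (k := k) (t := 4 ^ k) (by positivity)
    (pow_le_pow_right₀ (by norm_num) (Nat.le_succ k))
  have h2 : (4 : ℝ) ^ k * (1 / 2) ^ k = 2 ^ k := by
    rw [← mul_pow]
    norm_num
  have h3 := mul_le_mul_of_nonneg_left (h.lower k) (show (0 : ℝ) ≤ 4 ^ k by positivity)
  linarith

theorem levelSet_bddBelow (G : ℕ → ℝ) (j : ℕ) :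
    BddBelow {t : ℝ | 0 < t ∧ (j : ℝ) + 1 ≤ concaveHull G t} :=
  ⟨0, fun _ ht => ht.1.le⟩

theorem levelPoint_le {j : ℕ} {t : ℝ} (ht : 0 < t) (hj : (j : ℝ) + 1 ≤ concaveHull G t) :
    levelPoint G j ≤ t :=
  csInf_le (levelSet_bddBelow G j) ⟨ht, hj⟩

theorem levelPoint_pos (h : SlopeSeq G) (j : ℕ) : 0 < levelPoint G j := by
  have h0 := h.pos 0
  refine lt_of_lt_of_le (show 0 < ((j : ℝ) + 1) / (5 * G 0) by positivity)
    (le_csInf (h.levelSet_nonempty j) fun t ht => ?_)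
  rw [div_le_iff₀ (by positivity), mul_comm]
  exact ht.2.trans (h.concaveHull_le ht.1.le)

theorem level_le (h : SlopeSeq G) {j : ℕ} {t : ℝ} (ht : levelPoint G j < t) :
    (j : ℝ) + 1 ≤ concaveHull G t := by
  obtain ⟨s, hs, hst⟩ := exists_lt_of_csInf_lt (h.levelSet_nonempty j) ht
  exact hs.2.trans (h.concaveHull_mono hs.1.le hst.le)

/-- Since `concaveHull G t / t` decreases, `concaveHull G (x * t) ≥ x * concaveHull G t` for `0 < x
≤ 1`. Scaling by `(i + 1) / (j + 1)` thus sends points of level `j + 1` to points of level at least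
`i + 1`. -/
theorem levelPoint_div_mono (h : SlopeSeq G) {i j : ℕ} (hij : i ≤ j) :
    levelPoint G i * (j + 1) ≤ levelPoint G j * (i + 1) := by
  have hi : (0 : ℝ) < (i : ℝ) + 1 := by positivity
  have hj : (0 : ℝ) < (j : ℝ) + 1 := by positivity
  have hle : (i : ℝ) + 1 ≤ j + 1 := by
    have : (i : ℝ) ≤ j := by exact_mod_cast hij
    linarith
  rw [← div_le_iff₀ hi]
  refine le_csInf (h.levelSet_nonempty j) fun t ht => ?_
  have hc1 : ((i : ℝ) + 1) / (j + 1) ≤ 1 := (div_le_one hj).2 hle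
  have hc0 : 0 < ((i : ℝ) + 1) / (j + 1) := by positivity
  have hct : 0 < ((i : ℝ) + 1) / (j + 1) * t := mul_pos hc0 ht.1
  have h1 := h.slopeAvg_anti hct.le (mul_le_of_le_one_left ht.1.le hc1)
  have h2 : ((i : ℝ) + 1) / (j + 1) * concaveHull G t
      ≤ concaveHull G (((i : ℝ) + 1) / (j + 1) * t) := by
    have := mul_le_mul_of_nonneg_left h1 hct.le
    unfold concaveHull
    linarith
  have h3 : (i : ℝ) + 1 ≤ ((i : ℝ) + 1) / (j + 1) * concaveHull G t := by
    rw [div_mul_eq_mul_div, le_div_iff₀ hj]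
    exact mul_le_mul_of_nonneg_left ht.2 hi.le
  have h4 := levelPoint_le hct (h3.trans h2)
  rw [div_le_iff₀ hi]
  rw [div_mul_eq_mul_div, le_div_iff₀ hj] at h4
  linarith

/-- Each summand is the integral of `t ^ (-2)` beyond the level point, cut off at `1`. At a given
`t`, the number of level points already passed is at most `⌊concaveHull G t⌋₊`. -/
theorem sum_inv_max_levelPoint_le (h : SlopeSeq G) (n : ℕ) :
    ∑ j ∈ Finset.range n, (max 1 (levelPoint G j))⁻¹
      ≤ ∫ t in Ioi (1 : ℝ), concaveHull G t / t ^ 2 := by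
  have hm : ∀ j, 1 ≤ max 1 (levelPoint G j) := fun j => le_max_left _ _
  have hint : ∀ j, IntegrableOn (fun t : ℝ => t ^ (-2 : ℝ)) (Ioi (max 1 (levelPoint G j))) :=
    fun j => integrableOn_Ioi_rpow_of_lt (by norm_num) (lt_of_lt_of_le one_pos (hm j))
  have hind : ∀ j, IntegrableOn
      ((Ioi (max 1 (levelPoint G j))).indicator fun t : ℝ => t ^ (-2 : ℝ)) (Ioi 1) := fun j =>
    ((integrable_indicator_iff measurableSet_Ioi).2 (hint j)).integrableOn
  have e : ∀ j, (max 1 (levelPoint G j))⁻¹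
      = ∫ t in Ioi (1 : ℝ), (Ioi (max 1 (levelPoint G j))).indicator (fun t => t ^ (-2 : ℝ)) t := by
    intro j
    rw [setIntegral_indicator measurableSet_Ioi,
      inter_eq_self_of_subset_right (Ioi_subset_Ioi (hm j)),
      integral_Ioi_rpow_of_lt (by norm_num) (lt_of_lt_of_le one_pos (hm j))]
    norm_num [Real.rpow_neg_one]
  simp only [e]
  rw [← integral_finsetSum _ fun j _ => hind j]
  refine setIntegral_mono_on (integrable_finsetSum _ fun j _ => hind j)
    h.integrableOn_concaveHull measurableSet_Ioi fun t ht => ?_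
  have ht0 : (0 : ℝ) < t := lt_trans one_pos ht
  have hβ := h.concaveHull_nonneg ht0.le
  have h2 : t ^ (-2 : ℝ) = 1 / t ^ 2 := by
    rw [Real.rpow_neg ht0.le, Real.rpow_two, one_div]
  calc _ ≤ ∑ j ∈ Finset.range n, if j ∈ Finset.range ⌊concaveHull G t⌋₊ then 1 / t ^ 2 else 0 := by
        refine Finset.sum_le_sum fun j _ => ?_
        by_cases hj : t ∈ Ioi (max 1 (levelPoint G j))
        · have h3 := h.level_le (lt_of_le_of_lt (le_max_right _ _) hj)
          have h4 : j ∈ Finset.range ⌊concaveHull G t⌋₊ :=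
            Finset.mem_range.2 (Nat.le_floor (by push_cast; exact h3))
          rw [indicator_of_mem hj, if_pos h4, h2]
        · rw [indicator_of_notMem hj]
          split_ifs <;> positivity
    _ ≤ ∑ j ∈ Finset.range ⌊concaveHull G t⌋₊, 1 / t ^ 2 := by
        rw [← Finset.sum_filter]
        refine Finset.sum_le_sum_of_subset_of_nonneg (fun j hj => (Finset.mem_filter.1 hj).2)
          fun _ _ _ => by positivity
    _ ≤ _ := by
        rw [Finset.sum_const, Finset.card_range, nsmul_eq_mul, mul_one_div]
        gcongr
        exact Nat.floor_le hβ

theorem summable_inv_levelPoint (h : SlopeSeq G) : Summable fun j => (levelPoint G j)⁻¹ := by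
  have hs : Summable fun j => (max 1 (levelPoint G j))⁻¹ :=
    summable_of_sum_range_le (fun j => by positivity) h.sum_inv_max_levelPoint_le
  refine Summable.of_nonneg_of_le (fun j => (inv_pos.2 (h.levelPoint_pos j)).le) (fun j => ?_)
    (hs.mul_left (max 1 (levelPoint G 0)⁻¹))
  have hj := h.levelPoint_pos j
  have h0 := h.levelPoint_pos 0
  have hmono : levelPoint G 0 ≤ levelPoint G j := by
    have h1 := h.levelPoint_div_mono (Nat.zero_le j)
    push_cast at h1
    nlinarith [show (0 : ℝ) ≤ j by positivity]
  rcases le_total 1 (levelPoint G j) with h1 | h1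
  · rw [max_eq_right h1]
    exact le_mul_of_one_le_left (inv_pos.2 hj).le (le_max_left _ _)
  · rw [max_eq_left h1, inv_one, mul_one]
    exact le_max_of_le_right (inv_anti₀ h0 hmono)

theorem admissibleRecip_levelPoint (h : SlopeSeq G) :
    AdmissibleRecip fun j => (levelPoint G j)⁻¹ where
  nonneg j := (inv_pos.2 (h.levelPoint_pos j)).le
  pos := inv_pos.2 (h.levelPoint_pos 0)
  summable := h.summable_inv_levelPoint
  anti := by
    intro i j hij
    have hi := h.levelPoint_pos i
    have hj := h.levelPoint_pos j
    simp only [← div_eq_mul_inv]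
    rw [div_le_div_iff₀ hj hi]
    linarith [h.levelPoint_div_mono hij]

theorem exists_concaveHull_le_logMax (h : SlopeSeq G) :
    ∃ τ : ℕ → ℝ≥0∞, AdmissibleSeq τ ∧ ∀ t : ℝ, 0 < t → concaveHull G t ≤ 1 + logMax τ t := by
  -- With the factor `e`, every level point at most `t` contributes a factor at least `e` to the
  -- power term. Taking `⌊concaveHull G t⌋₊` of them gives the bound; the floor costs the constant
  -- `1`.
  have hρ := h.admissibleRecip_levelPoint.const_mul (Real.exp_pos 1)
  refine ⟨_, hρ.admissibleSeq, fun t ht => ?_⟩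
  have hb := hρ.admissibleSeq.bddAbove_powTerm ht.le
  set τ : ℕ → ℝ≥0∞ := fun j => (ENNReal.ofReal (Real.exp 1 * (levelPoint G j)⁻¹))⁻¹
  have hτ : recip τ = fun j => Real.exp 1 * (levelPoint G j)⁻¹ := recip_inv_ofReal hρ.nonneg
  have hβ := h.concaveHull_nonneg ht.le
  have hfl := Nat.lt_floor_add_one (concaveHull G t)
  have hfle := Nat.floor_le hβ
  suffices hn : (⌊concaveHull G t⌋₊ : ℝ) ≤ logMax τ t by linarith
  rw [logMax, Real.le_log_iff_exp_le (lt_of_lt_of_le one_pos (le_max_left _ _))]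
  rcases hfloor : ⌊concaveHull G t⌋₊ with _ | n
  · simp
  · rw [hfloor] at hfle
    refine le_max_of_le_right (le_trans ?_ (le_ciSup hb n))
    have e1 : Real.exp ((n + 1 : ℕ) : ℝ) = ∏ _j ∈ Finset.range (n + 1), Real.exp 1 := by
      rw [Finset.prod_const, Finset.card_range, ← Real.exp_nat_mul, mul_one]
    have e2 : powTerm τ (n + 1) t
        = ∏ j ∈ Finset.range (n + 1), (t * (Real.exp 1 * (levelPoint G j)⁻¹)) := by
      rw [powTerm, hτ, Finset.prod_mul_distrib (f := fun _ => t), Finset.prod_const,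
        Finset.card_range]
    rw [e1, e2]
    refine Finset.prod_le_prod (fun _ _ => (Real.exp_pos 1).le) fun j hj => ?_
    have hjn : (j : ℝ) + 1 ≤ ((n + 1 : ℕ) : ℝ) := by
      exact_mod_cast Finset.mem_range.1 hj
    have hl := levelPoint_le ht (hjn.trans hfle)
    have hp := h.levelPoint_pos j
    rw [mul_left_comm, ← div_eq_mul_inv]
    exact le_mul_of_one_le_right (Real.exp_pos 1).le ((one_le_div hp).2 hl)

end SlopeSeq

theorem HasSummableSlopes.exists_le_logMax {f : ℝ → ℝ} (hf : HasSummableSlopes f) :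
    ∃ τ : ℕ → ℝ≥0∞, AdmissibleSeq τ ∧ ∃ c : ℝ, 0 ≤ c ∧
      ∀ t : ℝ, 0 < t → f t ≤ c + logMax τ t := by
  obtain ⟨c, G, hc, hG, h1, hk⟩ := hf.exists_slopeSeq
  obtain ⟨τ, hτ, hle⟩ := hG.exists_concaveHull_le_logMax
  refine ⟨τ, hτ, c + 1, by linarith, fun t ht => ?_⟩
  have h2 := hle t ht
  rcases le_total t 1 with h | h
  · linarith [h1 t ht h, hG.concaveHull_nonneg ht.le]
  · obtain ⟨k, hk1, hk2⟩ := exists_pow_four_near h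
    linarith [hk k t hk1, hG.le_concaveHull ht.le hk2.le]

end NonQuasi

/-! ### The cycle of implications; the analytic steps are `1 → 6` and `7 → 4`. -/

theorem theorem4p4 (f : ℝ → ℝ) (hf : NonQuasi.PosOnPos f) :
    List.TFAE
      [ -- (i)
        ∃ α : ℝ → ℝ, NonQuasi.PosOnPos α ∧ NonQuasi.LebesgueMeasurableOnPos α ∧
          NonQuasi.SubadditiveOnPos α ∧ NonQuasi.BoundedNearZero α ∧
          NonQuasi.NonQuasianalytic α ∧ NonQuasi.MajorizedBy f α,
        -- (ii)
        ∃ α : ℝ → ℝ, NonQuasi.PosOnPos α ∧ ContinuousOn α (Set.Ioi 0) ∧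
          NonQuasi.BoundedNearZero α ∧ NonQuasi.NonQuasianalytic α ∧
          AntitoneOn (fun t : ℝ => α t / t) (Set.Ioi 0) ∧ NonQuasi.MajorizedBy f α,
        -- (iii)
        ∃ α : ℝ → ℝ, NonQuasi.PosOnPos α ∧ MonotoneOn α (Set.Ioi 0) ∧
          ConcaveOn ℝ (Set.Ioi 0) α ∧ NonQuasi.NonQuasianalytic α ∧ NonQuasi.MajorizedBy f α,
        -- (iv)
        ∃ α : ℝ → ℝ, NonQuasi.PosOnPos α ∧ ContDiffOn ℝ ∞ α (Set.Ioi 0) ∧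
          MonotoneOn α (Set.Ioi 0) ∧ ConcaveOn ℝ (Set.Ioi 0) α ∧
          NonQuasi.NonQuasianalytic α ∧ NonQuasi.MajorizedBy f α,
        -- (v)
        ∃ τ : ℕ → ℝ≥0∞, NonQuasi.AdmissibleSeq τ ∧ ∃ c : ℝ, 0 ≤ c ∧
          ∀ t : ℝ, 0 < t → f t ≤ c + NonQuasi.logSeries τ t,
        -- (vi)
        ∃ τ : ℕ → ℝ≥0∞, NonQuasi.AdmissibleSeq τ ∧ ∃ c : ℝ, 0 ≤ c ∧
          ∀ t : ℝ, 0 < t → f t ≤ c + NonQuasi.logMax τ t,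
        -- (vii)
        ∃ w ∈ NonQuasi.Omega0, ∃ c : ℝ, 0 ≤ c ∧
          ∀ t : ℝ, 0 < t → f t ≤ c + Real.log ‖w (t : ℂ)‖ ] ∧
    ((∃ α : ℝ → ℝ, NonQuasi.PosOnPos α ∧ NonQuasi.LebesgueMeasurableOnPos α ∧
          NonQuasi.SubadditiveOnPos α ∧ NonQuasi.BoundedNearZero α ∧
          NonQuasi.NonQuasianalytic α ∧ NonQuasi.MajorizedBy f α) →
      Tendsto (fun t : ℝ => f t * Real.log t / t) atTop (𝓝 0)) := by
  have hslopes : (∃ α : ℝ → ℝ, NonQuasi.PosOnPos α ∧ NonQuasi.LebesgueMeasurableOnPos α ∧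
      NonQuasi.SubadditiveOnPos α ∧ NonQuasi.BoundedNearZero α ∧ NonQuasi.NonQuasianalytic α ∧
      NonQuasi.MajorizedBy f α) → NonQuasi.HasSummableSlopes f := by
    rintro ⟨α, hpos, -, hsub, hbdd, hnq, hmaj⟩
    exact NonQuasi.hasSummableSlopes_of_subadditive hpos hsub hbdd hnq.2 hmaj
  refine ⟨?_, fun h => (hslopes h).tendsto_mul_log_div hf⟩
  tfae_have 1 → 6 := fun h => (hslopes h).exists_le_logMax
  tfae_have 6 → 5 := by
    rintro ⟨τ, hτ, c, hc, h⟩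
    exact ⟨τ, hτ, c, hc, fun t ht => (h t ht).trans (by linarith [hτ.logMax_le_logSeries ht.le])⟩
  tfae_have 5 → 7 := by
    rintro ⟨τ, hτ, c, hc, h⟩
    obtain ⟨w, hw, hle⟩ := hτ.logSeries_le
    exact ⟨w, hw, c + Real.log 2, add_nonneg hc (Real.log_nonneg one_le_two), fun t ht => by
      linarith [h t ht, hle t ht]⟩
  tfae_have 7 → 4 := by
    rintro ⟨w, hw, c, hc, h⟩
    exact (NonQuasi.hasSummableSlopes_of_omega hw hc h).exists_smooth_concave
  tfae_have 4 → 3 := by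
    rintro ⟨α, hpos, -, hmono, hconc, hnq, hmaj⟩
    exact ⟨α, hpos, hmono, hconc, hnq, hmaj⟩
  tfae_have 3 → 2 := by
    rintro ⟨α, hpos, hmono, hconc, hnq, hmaj⟩
    refine ⟨α, hpos, hconc.continuousOn isOpen_Ioi, ⟨α 1, fun t ht ht1 => ?_⟩, hnq,
      NonQuasi.antitoneOn_div_of_concaveOn hpos hconc, hmaj⟩
    rw [abs_of_pos (hpos t ht)]
    exact hmono ht (Set.mem_Ioi.2 one_pos) ht1
  tfae_have 2 → 1 := by
    rintro ⟨α, hpos, -, hbdd, hnq, hanti, hmaj⟩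
    exact ⟨α, hpos, hnq.1, NonQuasi.subadditiveOnPos_of_antitoneOn_div hanti, hbdd, hnq, hmaj⟩
  tfae_finish
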